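/- Fix a dimension $d$. A \emph{curve} is a finite nonempty sequence of distinct vertices of $\mathbb{Z}^d$ in which consecutive vertices form an \emph{edge}, i.e. differ by $\pm$ a unit vector; this signed unit vector is the \emph{direction} of the edge, and the index of the coordinate that changes is its \emph{axis}. A \emph{$k$-curve} is a curve that visits exactly the $2^{dk}$ grid points of a translate of $\{0,\dots,2^k-1\}^d$. An \emph{isometric image} of a curve is its image under a distance-preserving map of $\mathbb{Z}^d$, possibly traversed in reverse order. Let $G(d)$ be the curve, determined up to translation by its list of directions, that follows the binary reflected Gray code: $G(0)$ is empty, and $G(d)$ is $G(d-1)$, followed by the positive direction along axis $d$, followed by the reverse of $G(d-1)$ (order reversed and directions negated). A curve $B$ is obtained from a curve $A$ by \emph{inflation} if $B$ is the concatenation, in order, of $1$-curves (child curves), one for each vertex $v$ of $A$, the child curve of $v$ visiting exactly $2v+\{0,1\}^d$, where each edge of $A$ is replaced by an edge of the same direction from the last vertex of one child curve to the first vertex of the next. A curve is \emph{well-folded} if it is a single vertex, or is obtained by inflation from a well-folded curve with all child curves isometric images of $G(d)$. A curve is \emph{hyperorthogonal} if for each $n\in\{0,\dots,d-2\}$ every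 sequence of $2^n$ consecutive edges has exactly $n+1$ different axes. A \emph{$d$-dimensional space-filling curve} is a continuous surjective map $f:[0,1]\to[0,1]^d$. It is \emph{approximated} by $A_0,A_1,\dots$ if $A_0$ is the single vertex $(0,\dots,0)$, each $A_k$ is a $k$-curve on $\{0,\dots,2^k-1\}^d$, each $A_{k+1}$ is obtained from $A_k$ by inflation, and for all $k$ and $1\le i\le 2^{dk}$, if $v$ is the $i$-th vertex of $A_k$, then $f$ maps $[(i-1)/2^{dk},\,i/2^{dk}]$ onto the cube $2^{-k}(v+[0,1]^d)$. (The $A_k$ are then determined by $f$.) Such an $f$ is \emph{well-folded}, respectively \emph{hyperorthogonal}, if all its approximating curves $A_k$ are, and \emph{self-similar} if for each $k\ge 0$ the curve $A_{k+1}$ is the concatenation of $2^d$ isometric images of $A_k$. \textbf{Theorem.} For every $d\ge 3$ there is a self-similar, hyperorthogonal, well-folded $d$-dimensional space-filling curve $f$ with $f(0)=(0,\dots,0,0)$, and there is a self-similar, hyperorthogonal, well-folded $d$-dimensional space-filling curve $f$ with $f(0)=(\tfrac13,\dots,\tfrac13,0)$. -/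

import Mathlib

/-! ### Curves on the integer grid -/

/-- A vertex of the `d`-dimensional integer grid. -/
abbrev Vertex (d : ℕ) := Fin d → ℤ

/-- A direction: an axis together with a sign.  The axes `1, …, d` are the elements
`0, …, d - 1` of `Fin d`. -/
abbrev Direction (d : ℕ) := Fin d × ℤˣ

namespace Direction

/-- The unit vector of a direction. -/
def vec {d : ℕ} (e : Direction d) : Vertex d := Pi.single e.1 (e.2 : ℤ)

/-- The axis of a direction. -/
def axis {d : ℕ} (e : Direction d) : Fin d := e.1

/-- The opposite direction. -/
def opp {d : ℕ} (e : Direction d) : Direction d := (e.1, -e.2)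

end Direction

/-- The vertices, in order, of the path that starts in `v` and whose consecutive edges have the
given directions. -/
def gridPath {d : ℕ} : Vertex d → List (Direction d) → List (Vertex d)
  | v, [] => [v]
  | v, e :: es => v :: gridPath (v + e.vec) es

/-- `A` is a nonempty sequence of vertices whose consecutive pairs are edges, and the directions
of these edges are, in order, the elements of `es`. -/
def HasDirections {d : ℕ} (A : List (Vertex d)) (es : List (Direction d)) : Prop :=
  ∃ v : Vertex d, A = gridPath v es

/-- A curve on the grid: a sequence of distinct vertices, consecutive ones forming an edge. -/
def IsGridCurve {d : ℕ} (A : List (Vertex d)) : Prop :=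
  A.Nodup ∧ ∃ es : List (Direction d), HasDirections A es

/-- A `k`-curve on the `k`-cube with smallest corner `c`: a Hamiltonian path on the `2 ^ (d * k)`
grid points of that cube. -/
def IsKCurve {d : ℕ} (k : ℕ) (c : Vertex d) (A : List (Vertex d)) : Prop :=
  IsGridCurve A ∧ ∀ w : Vertex d, w ∈ A ↔ ∀ j, c j ≤ w j ∧ w j < c j + 2 ^ k

/-! ### Isometries -/

/-- Maps of the grid that preserve Euclidean distances. -/
def IsGridIsometry {d : ℕ} (φ : Vertex d → Vertex d) : Prop :=
  ∀ x y : Vertex d, ∑ j, (φ x j - φ y j) ^ 2 = ∑ j, (x j - y j) ^ 2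

/-- `B` is an isometric image of `A`; reversing the curve is allowed. -/
def IsIsometricImage {d : ℕ} (A B : List (Vertex d)) : Prop :=
  ∃ φ : Vertex d → Vertex d, IsGridIsometry φ ∧ (B = A.map φ ∨ B = (A.map φ).reverse)

/-! ### Gray codes, inflation, well-folded curves -/

/-- The reverse of a free curve, a free curve being given by its list of directions. -/
def reverseFree {d : ℕ} (es : List (Direction d)) : List (Direction d) :=
  es.reverse.map Direction.opp

/-- The free curve `G(d)` that follows the binary reflected Gray code. -/
def grayCode : (d : ℕ) → List (Direction d)
  | 0 => []
  | d + 1 =>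
    let G : List (Direction (d + 1)) := (grayCode d).map fun e => (e.1.castSucc, e.2)
    G ++ [(Fin.last d, 1)] ++ reverseFree G

/-- The curve `B` is obtained from the parent curve `A` by inflation with the child curves `Cs`:
every vertex `v` of `A` is replaced by a 1-curve on the unit cube translated by `2 * v`, and
every edge of `A` is replaced by an edge of the same direction, from the exit of a child curve to
the entry of the next one. -/
structure IsInflation {d : ℕ} (A : List (Vertex d)) (Cs : List (List (Vertex d)))
    (B : List (Vertex d)) : Prop where
  children : List.Forall₂ (fun v C => IsKCurve 1 (2 • v) C) A Cs
  edges : List.IsChain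
    (fun p q : Vertex d × List (Vertex d) =>
      ∃ x y : Vertex d, p.2.getLast? = some x ∧ q.2.head? = some y ∧ y - x = q.1 - p.1)
    (A.zip Cs)
  concat : B = Cs.flatten
  curve : IsGridCurve B

/-- A curve is well-folded if it is a single vertex, or if it is obtained by inflating a
well-folded curve, the child curves being isometric images of `G(d)`. -/
inductive WellFolded {d : ℕ} : List (Vertex d) → Prop
  | single (v : Vertex d) : WellFolded [v]
  | inflate (A : List (Vertex d)) (Cs : List (List (Vertex d))) (B : List (Vertex d)) :
      WellFolded A → IsInflation A Cs B →
      (∀ C ∈ Cs, IsIsometricImage (gridPath 0 (grayCode d)) C) → WellFolded B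

/-! ### Hyperorthogonality and self-similarity -/

/-- A curve is hyperorthogonal if, for each `n` in `{0, …, d - 2}`, each sequence of `2 ^ n`
consecutive edges has exactly `n + 1` different axes. -/
def Hyperorthogonal {d : ℕ} (A : List (Vertex d)) : Prop :=
  ∀ es : List (Direction d), HasDirections A es →
    ∀ n : ℕ, n + 2 ≤ d → ∀ s : List (Direction d), s <:+: es → s.length = 2 ^ n →
      (s.map Direction.axis).toFinset.card = n + 1

/-- `B` is the concatenation of `2 ^ d` isometric copies (possibly reversed) of `A`. -/
def IsConcatOfCopies {d : ℕ} (A B : List (Vertex d)) : Prop :=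
  ∃ Cs : List (List (Vertex d)), Cs.length = 2 ^ d ∧ (∀ C ∈ Cs, IsIsometricImage A C) ∧
    B = Cs.flatten

/-! ### Space-filling curves -/

/-- A space-filling curve: a continuous map from `[0,1]` onto `[0,1]^d`. -/
def IsSpaceFillingCurve {d : ℕ} (f : unitInterval → Fin d → unitInterval) : Prop :=
  Continuous f ∧ Function.Surjective f

/-- The sequence `A 0, A 1, …` approximates `f`: `A 0` is a single vertex, `A k` is a `k`-curve
on `{0, …, 2 ^ k - 1}^d`, `A (k + 1)` is obtained from `A k` by inflation, and `f` maps the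
`i`-th of the `2 ^ (d * k)` intervals into which `[0,1]` is subdivided onto the cube of width
`1 / 2 ^ k` that is represented by the `i`-th vertex of `A k` (`i` is counted from `0`). -/
structure Approximates {d : ℕ} (A : ℕ → List (Vertex d))
    (f : unitInterval → Fin d → unitInterval) : Prop where
  zero : A 0 = [0]
  kCurve : ∀ k, IsKCurve k 0 (A k)
  inflation : ∀ k, ∃ Cs : List (List (Vertex d)), IsInflation (A k) Cs (A (k + 1))
  image : ∀ (k i : ℕ) (v : Vertex d), (A k)[i]? = some v →
    f '' {t | (i : ℝ) / 2 ^ (d * k) ≤ t ∧ (t : ℝ) ≤ ((i : ℝ) + 1) / 2 ^ (d * k)} =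
      {x | ∀ j, (v j : ℝ) / 2 ^ k ≤ x j ∧ (x j : ℝ) ≤ ((v j : ℝ) + 1) / 2 ^ k}

/-- `f` is a self-similar, hyperorthogonal, well-folded space-filling curve: it is approximated by
curves `A 0, A 1, …` that are well-folded and hyperorthogonal and such that each `A (k + 1)` is
the concatenation of `2 ^ d` isometric copies of `A k`.  (A sequence that approximates `f` is
determined by `f`.) -/
structure IsSelfSimilarHyperorthogonalWellFolded {d : ℕ}
    (f : unitInterval → Fin d → unitInterval) : Prop where
  spaceFilling : IsSpaceFillingCurve f
  approximating : ∃ A : ℕ → List (Vertex d), Approximates A f ∧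
    (∀ k, WellFolded (A k)) ∧ (∀ k, Hyperorthogonal (A k)) ∧
    (∀ k, IsConcatOfCopies (A k) (A (k + 1)))

namespace CubeCurve

/-! ### Corners and the binary reflected Gray code -/

/-! Both curves come from a finite substitution. Every cube carries a label: a signed permutation of
the axes and a direction of traversal. Its children follow the correspondingly transformed Gray
code, and each child's label is the parent's label times a fixed generator. Well-foldedness is then
built in. Self-similarity is equivariance: the curve with label `g` is the image under `g` of the
curve with label `1` (`node_eq_act`), and a curve of level `k + 1` is made of the level-`k` curves
of the children (`node_succ_eq`).

The work lies in keeping consecutive cubes compatible. The invariant `Fits` asks that exit and entry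
match across a common axis, and that an axis in a low slot of either permutation sits at most one
slot higher in the other. It is imposed on siblings, and `Valid.fits_children` carries it from
consecutive cubes to the last child of one and the first child of the next; so it holds at all
levels (`Valid.step_node`).

Hyperorthogonality follows. Inside a cube, the `e`-th edge uses the axis in slot `ruler e`. A window
of `2 ^ n` edges contains one multiple `s` of `2 ^ n`, and all other edges use slots below `n`. If
the window straddles two cubes, its longer side uses all slots below `n` of its cube, while the
shorter side uses only slots below `n - 1`, which the slot condition places below `n` on the longer
side. That makes `n` axes, plus the axis of `s` (`card_image_window`).

The generators put the axes that the parent's Gray code uses close to a child into the last slots of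
that child. Balls of radius `2 ^ m` around one Gray code vertex lie in balls of radius `2 ^ (m + 1)`
around its neighbour, which gives the slot condition (`nearAxes_subset`, `childPerm_near`). A bit
`b` decides which of the last two slots is the entry axis, and whether the first child keeps its
parent's entry corner or has the opposite corner of the entry facet. Keeping it gives starting point
`0`; alternating gives binary digits `0.0101…`, that is `1/3`, in every coordinate except the entry
axis. -/

/-- The vertex of the unit cube given by a vector of bits. -/
def corner {d : ℕ} (c : Fin d → Bool) : Vertex d := fun x => ((c x).toNat : ℤ)

/-- The `c`-th codeword of the binary reflected Gray code. -/
def gray (d c : ℕ) : Fin d → Bool := fun x => c.testBit x ^^ c.testBit (x + 1)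

/-- The exponent of two in a number. -/
def ruler (e : ℕ) : ℕ := padicValNat 2 e

theorem ruler_odd (a : ℕ) : ruler (2 * a + 1) = 0 := by
  unfold ruler
  exact padicValNat.eq_zero_of_not_dvd (by omega)

theorem ruler_even {a : ℕ} (ha : a ≠ 0) : ruler (2 * a) = ruler a + 1 := by
  unfold ruler
  rw [padicValNat.mul (by norm_num) ha, padicValNat.self (by norm_num)]
  omega

theorem two_pow_dvd_iff_le_ruler {n e : ℕ} (he : e ≠ 0) : 2 ^ n ∣ e ↔ n ≤ ruler e := by
  unfold ruler
  exact padicValNat_dvd_iff_le he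

theorem ruler_lt {d e : ℕ} (h0 : e ≠ 0) (he : e < 2 ^ d) : ruler e < d := by
  by_contra! h
  have := Nat.le_of_dvd (Nat.pos_of_ne_zero h0) ((two_pow_dvd_iff_le_ruler h0).2 h)
  omega

theorem ruler_sub {d e : ℕ} (h0 : e ≠ 0) (he : e < 2 ^ d) : ruler (2 ^ d - e) = ruler e := by
  have h1 : 2 ^ d - e ≠ 0 := by omega
  have hl := ruler_lt h0 he
  have hl' := ruler_lt h1 (show 2 ^ d - e < 2 ^ d by omega)
  refine le_antisymm ?_ ?_
  · rw [← two_pow_dvd_iff_le_ruler h0]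
    have h2 := (two_pow_dvd_iff_le_ruler h1).2 le_rfl
    have h3 : 2 ^ ruler (2 ^ d - e) ∣ 2 ^ d := pow_dvd_pow 2 hl'.le
    have := Nat.dvd_sub h3 h2
    rwa [show 2 ^ d - (2 ^ d - e) = e by omega] at this
  · rw [← two_pow_dvd_iff_le_ruler h1]
    exact Nat.dvd_sub (pow_dvd_pow 2 hl.le) ((two_pow_dvd_iff_le_ruler h0).2 le_rfl)

/-- Adding one flips the trailing ones and the zero above them, which are the bits up to position
`ruler (i + 1)`. -/
theorem testBit_succ_eq (i y : ℕ) :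
    (i + 1).testBit y = (i.testBit y ^^ decide (y ≤ ruler (i + 1))) := by
  induction i using Nat.strong_induction_on generalizing y with
  | _ i ih =>
    obtain ⟨a, rfl | rfl⟩ := Nat.even_or_odd' i
    · rw [ruler_odd]
      cases y with
      | zero => simp [Nat.testBit_zero]
      | succ y =>
        simp only [Nat.testBit_add_one]
        simp [show (2 * a + 1) / 2 = a by omega]
    · rw [show 2 * a + 1 + 1 = 2 * (a + 1) by ring, ruler_even (by omega)]
      cases y with
      | zero => simp [Nat.testBit_zero]
      | succ y =>
        simp only [Nat.testBit_add_one]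
        rw [show 2 * (a + 1) / 2 = a + 1 by omega, show (2 * a + 1) / 2 = a by omega,
          ih a (by omega)]
        simp

/-- A codeword bit compares two neighbouring binary digits, so flipping an initial run of digits
changes only the comparison at the upper end of the run. -/
theorem gray_succ (d i : ℕ) (x : Fin d) :
    gray d (i + 1) x = (gray d i x ^^ decide ((x : ℕ) = ruler (i + 1))) := by
  unfold gray
  rw [testBit_succ_eq, testBit_succ_eq]
  rcases lt_trichotomy (x : ℕ) (ruler (i + 1)) with h | h | h
  · simp [h.le, h.ne, Nat.succ_le_of_lt h]
  · simp [h]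
  · simp [h.not_ge, h.ne', show ¬ ((x : ℕ) + 1 ≤ ruler (i + 1)) by omega]

theorem gray_zero (d : ℕ) (x : Fin d) : gray d 0 x = false := by simp [gray]

/-- The reflection of the code: complementing all `d` digits leaves comparisons of neighbours alone,
except that the top digit is compared with a digit that stays `0`. -/
theorem gray_sub (d i : ℕ) (hi : i < 2 ^ d) (x : Fin d) :
    gray d (2 ^ d - 1 - i) x = (gray d i x ^^ decide ((x : ℕ) + 1 = d)) := by
  unfold gray
  rw [show 2 ^ d - 1 - i = 2 ^ d - (i + 1) by omega, Nat.testBit_two_pow_sub_succ hi,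
    Nat.testBit_two_pow_sub_succ hi]
  have hx := x.2
  rcases Nat.lt_or_ge ((x : ℕ) + 1) d with h | h
  · simp [h, h.ne]
  · have : (x : ℕ) + 1 = d := by omega
    have h2 : i.testBit ((x : ℕ) + 1) = false := by
      rw [this]; exact Nat.testBit_lt_two_pow hi
    simp [this]
    rw [this] at h2
    simp [h2]

theorem gray_last (d : ℕ) (x : Fin d) : gray d (2 ^ d - 1) x = decide ((x : ℕ) + 1 = d) := by
  have := gray_sub d 0 (by positivity) x
  simpa [gray_zero] using this

theorem gray_injOn {d i i' : ℕ} (hi : i < 2 ^ d) (hi' : i' < 2 ^ d)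
    (h : gray d i = gray d i') : i = i' := by
  apply Nat.eq_of_testBit_eq
  -- The digits are recovered from the top down; at and above position `d` both numbers have zeros.
  have key : ∀ n y, d ≤ y + n → i.testBit y = i'.testBit y := by
    intro n
    induction n with
    | zero =>
      intro y hy
      have hp : 2 ^ d ≤ 2 ^ y := Nat.pow_le_pow_right (by norm_num) hy
      rw [Nat.testBit_lt_two_pow (hi.trans_le hp), Nat.testBit_lt_two_pow (hi'.trans_le hp)]
    | succ n ih =>
      intro y hy
      rcases Nat.lt_or_ge y d with hd | hd
      · have h1 := congrFun h ⟨y, hd⟩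
        have h2 := ih (y + 1) (by omega)
        simp only [gray, h2] at h1
        simpa using h1
      · exact ih y (by omega)
  exact fun y => key d y (by omega)

theorem gray_surj {d : ℕ} (c : Fin d → Bool) : ∃ i < 2 ^ d, gray d i = c := by
  have hinj : Function.Injective fun i : Fin (2 ^ d) => gray d i :=
    fun i i' h => Fin.ext (gray_injOn i.2 i'.2 h)
  have hb := (Fintype.bijective_iff_injective_and_card _).2 ⟨hinj, by simp⟩
  obtain ⟨i, hi⟩ := hb.2 c
  exact ⟨i, i.2, hi⟩

/-! ### Grid paths -/

theorem length_gridPath {d : ℕ} (v : Vertex d) (es : List (Direction d)) :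
    (gridPath v es).length = es.length + 1 := by
  induction es generalizing v with
  | nil => rfl
  | cons e es ih => simp [gridPath, ih]

theorem gridPath_append_cons {d : ℕ} (v : Vertex d) (es : List (Direction d)) (e : Direction d)
    (fs : List (Direction d)) :
    gridPath v (es ++ e :: fs) =
      gridPath v es ++ gridPath (v + (es.map Direction.vec).sum + e.vec) fs := by
  induction es generalizing v with
  | nil => simp [gridPath]
  | cons a es ih => simp [gridPath, ih, add_assoc]

theorem gridPath_add {d : ℕ} (u v : Vertex d) (es : List (Direction d)) :
    gridPath (v + u) es = (gridPath v es).map (· + u) := by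
  induction es generalizing v with
  | nil => rfl
  | cons e es ih => simp [gridPath, ← ih, add_right_comm]

theorem vec_opp {d : ℕ} (e : Direction d) : e.opp.vec = -e.vec := by
  simp [Direction.opp, Direction.vec, Pi.single_neg]

theorem gridPath_reverseFree {d : ℕ} (v : Vertex d) (es : List (Direction d)) :
    gridPath (v + (es.map Direction.vec).sum) (reverseFree es) = (gridPath v es).reverse := by
  induction es generalizing v with
  | nil => simp [gridPath, reverseFree]
  | cons e es ih =>
    have h := ih (v + e.vec)
    have h2 : reverseFree (e :: es) = reverseFree es ++ e.opp :: [] := by simp [reverseFree]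
    rw [h2, gridPath_append_cons]
    have h3 : ((reverseFree es).map Direction.vec).sum = -(es.map Direction.vec).sum := by
      unfold reverseFree
      rw [List.map_map]
      rw [show Direction.vec ∘ Direction.opp = fun e : Direction d => -e.vec from
        funext fun e => vec_opp e]
      rw [List.map_reverse, List.sum_reverse]
      clear ih h h2
      induction es with
      | nil => simp
      | cons a es ih2 => simp [ih2, add_comm]
    rw [h3]
    simp only [List.map_cons, List.sum_cons, gridPath, List.reverse_cons]
    rw [← h, vec_opp]
    congr 2
    · abel
    · abel

theorem gridPath_map_castSucc {d : ℕ} (v : Vertex d) (a : ℤ) (es : List (Direction d)) :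
    gridPath (Fin.snoc v a : Vertex (d + 1)) (es.map fun e => (e.1.castSucc, e.2)) =
      (gridPath v es).map fun u => (Fin.snoc u a : Vertex (d + 1)) := by
  induction es generalizing v with
  | nil => rfl
  | cons e es ih =>
    simp only [List.map_cons, gridPath]
    rw [← ih]
    congr 2
    funext x
    refine Fin.lastCases ?_ (fun x => ?_) x
    · simp [Direction.vec]
    · simp [Direction.vec, Pi.single_apply, Fin.castSucc_inj]

/-- This links the recursive definition with the closed formula: the reversed second half is the
first half with the top bit set, by `gray_sub`. -/
theorem gridPath_grayCode (d : ℕ) :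
    gridPath 0 (grayCode d) = (List.range (2 ^ d)).map fun i => corner (gray d i) := by
  induction d with
  | zero =>
    simp only [grayCode, gridPath]
    simp
    exact Subsingleton.elim _ _
  | succ d ih =>
    set G : List (Direction (d + 1)) := (grayCode d).map fun e => (e.1.castSucc, e.2) with hG
    have hpath : gridPath 0 G = (List.range (2 ^ d)).map fun i => corner (gray (d + 1) i) := by
      have h := gridPath_map_castSucc 0 0 (grayCode d)
      have h0 : (Fin.snoc 0 0 : Vertex (d + 1)) = 0 := by
        funext x
        refine Fin.lastCases ?_ (fun x => ?_) x <;> simp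
      rw [h0, ih, List.map_map] at h
      rw [hG, h]
      refine List.map_congr_left fun i hi => ?_
      have hi' : i < 2 ^ d := List.mem_range.1 hi
      funext x
      refine Fin.lastCases ?_ (fun x => ?_) x
      · have h1 : i.testBit d = false := Nat.testBit_lt_two_pow hi'
        have h2 : i.testBit (d + 1) = false :=
          Nat.testBit_lt_two_pow (hi'.trans_le (Nat.pow_le_pow_right (by norm_num) (by omega)))
        simp [corner, gray, h1, h2]
      · simp [corner, gray]
    have hsplit : grayCode (d + 1) = G ++ (Fin.last d, 1) :: reverseFree G := by
      simp [grayCode, hG]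
    set e : Direction (d + 1) := (Fin.last d, 1) with he
    rw [hsplit, gridPath_append_cons, add_right_comm, gridPath_reverseFree, gridPath_add, hpath,
      pow_succ, mul_two, List.range_add, List.map_append, List.map_map, List.map_map]
    congr 1
    apply List.ext_getElem
    · simp
    intro n h1 h2
    simp only [List.length_map, List.length_range, List.length_reverse] at h1 h2
    have hlt : 2 ^ d - 1 - n < 2 ^ (d + 1) := by rw [pow_succ]; omega
    have hs := gray_sub (d + 1) (2 ^ d - 1 - n) hlt
    rw [show 2 ^ (d + 1) - 1 - (2 ^ d - 1 - n) = 2 ^ d + n by rw [pow_succ]; omega] at hs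
    simp only [List.getElem_reverse, List.getElem_map, List.length_map, List.length_range,
      List.getElem_range, Function.comp_apply]
    funext x
    simp only [corner, hs, Pi.add_apply]
    refine Fin.lastCases ?_ (fun x => ?_) x
    · have hb : gray (d + 1) (2 ^ d - 1 - n) (Fin.last d) = false := by
        have h1 : (2 ^ d - 1 - n).testBit d = false := Nat.testBit_lt_two_pow (by omega)
        have h2 : (2 ^ d - 1 - n).testBit (d + 1) = false :=
          Nat.testBit_lt_two_pow (by rw [pow_succ]; omega)
        simp [gray, h1, h2]
      simp [hb, he, Direction.vec]
    · have := x.2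
      simp [he, Direction.vec, this.ne]

theorem exists_gridPath_of_isChain {d : ℕ} (l : List (Vertex d)) (hl : l ≠ [])
    (h : l.IsChain fun x y => ∃ e : Direction d, y = x + e.vec) :
    ∃ es : List (Direction d), HasDirections l es := by
  induction l with
  | nil => exact absurd rfl hl
  | cons a l ih =>
    cases l with
    | nil => exact ⟨[], a, rfl⟩
    | cons b l =>
      rw [List.isChain_cons_cons] at h
      obtain ⟨⟨e, he⟩, h2⟩ := h
      obtain ⟨es, v, hv⟩ := ih (by simp) h2
      refine ⟨e :: es, a, ?_⟩
      simp only [gridPath]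
      have hb : v = b := by
        cases es <;> simp [gridPath] at hv <;> simp_all
      rw [← he, ← hb, ← hv, hb]

theorem getElem_gridPath_succ {d : ℕ} (v : Vertex d) (es : List (Direction d)) (n : ℕ)
    (h : n < es.length) :
    (gridPath v es)[n + 1]'(by rw [length_gridPath]; omega) =
      (gridPath v es)[n]'(by rw [length_gridPath]; omega) + es[n].vec := by
  induction es generalizing v n with
  | nil => simp at h
  | cons e es ih =>
    cases n with
    | zero => cases es <;> simp [gridPath]
    | succ n =>
      simp only [gridPath, List.getElem_cons_succ]
      exact ih _ _ (by simpa using h)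

theorem axis_eq_of_vec_eq {d : ℕ} (e : Direction d) (j : Fin d) (s : ℤ) (hs : s ≠ 0)
    (h : e.vec = Pi.single j s) : e.axis = j := by
  by_contra hne
  have := congrFun h j
  rw [Pi.single_eq_same, Direction.vec, Pi.single_eq_of_ne (fun h' : j = e.1 => hne h'.symm)] at this
  exact hs this.symm

end CubeCurve

namespace CubeCurve

/-! ### Labels: isometries of the cube, together with a direction of traversal -/

/-- A symmetry of the cube and a bit that tells whether the curve is traversed backwards. -/
@[ext] structure Label (d : ℕ) where
  /-- the permutation of the axes -/
  perm : Equiv.Perm (Fin d)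
  /-- the axes along which the image is reflected -/
  flip : Fin d → Bool
  /-- whether the curve is traversed backwards -/
  rev : Bool

namespace Label

variable {d : ℕ}

instance : One (Label d) := ⟨⟨1, fun _ => false, false⟩⟩

/-- The product applies `h` first; therefore its reflections are moved by the permutation of `g`. -/
instance : Mul (Label d) :=
  ⟨fun g h => ⟨g.perm * h.perm, fun x => g.flip x ^^ h.flip (g.perm.symm x), g.rev ^^ h.rev⟩⟩

theorem mul_perm_apply (g h : Label d) (x : Fin d) : (g * h).perm x = g.perm (h.perm x) := rfl

theorem mul_perm_symm_apply (g h : Label d) (x : Fin d) :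
    (g * h).perm.symm x = h.perm.symm (g.perm.symm x) := rfl

theorem mul_flip (g h : Label d) (x : Fin d) :
    (g * h).flip x = (g.flip x ^^ h.flip (g.perm.symm x)) := rfl

theorem mul_rev (g h : Label d) : (g * h).rev = (g.rev ^^ h.rev) := rfl

theorem one_perm_apply (x : Fin d) : (1 : Label d).perm x = x := rfl

theorem one_flip (x : Fin d) : (1 : Label d).flip x = false := rfl

theorem one_rev : (1 : Label d).rev = false := rfl

theorem mul_assoc' (g h k : Label d) : g * h * k = g * (h * k) := by
  ext x
  · rfl
  · simp [mul_flip, mul_perm_symm_apply]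
  · simp [mul_rev]

theorem mul_one' (g : Label d) : g * 1 = g := by
  ext x
  · rfl
  · simp [mul_flip, one_flip]
  · simp [mul_rev, one_rev]

/-- The same symmetry, with the opposite direction of traversal. -/
def reverse (g : Label d) : Label d := ⟨g.perm, g.flip, !g.rev⟩

/-- The action on the corners of the unit cube. -/
def cornerAct (g : Label d) (c : Fin d → Bool) : Fin d → Bool :=
  fun x => c (g.perm.symm x) ^^ g.flip x

/-- The action on the grid points of the cube of width `2 ^ k`. -/
def act (k : ℕ) (g : Label d) (v : Vertex d) : Vertex d :=
  fun x => if g.flip x then 2 ^ k - 1 - v (g.perm.symm x) else v (g.perm.symm x)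

theorem cornerAct_mul (g h : Label d) (c : Fin d → Bool) :
    (g * h).cornerAct c = g.cornerAct (h.cornerAct c) := by
  funext x
  simp only [cornerAct, mul_flip, mul_perm_symm_apply]
  cases g.flip x <;> simp

theorem act_one_corner (g : Label d) (c : Fin d → Bool) :
    act 1 g (corner c) = corner (g.cornerAct c) := by
  funext x
  simp only [act, corner, cornerAct]
  cases g.flip x <;> cases c (g.perm.symm x) <;> simp

theorem act_succ (k : ℕ) (g : Label d) (v : Vertex d) (c : Fin d → Bool) :
    act (k + 1) g (2 • v + corner c) = 2 • act k g v + corner (g.cornerAct c) := by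
  funext x
  simp only [act, corner, cornerAct, Pi.add_apply, nsmul_eq_mul, Nat.cast_ofNat,
    Pi.mul_apply, Pi.ofNat_apply]
  cases g.flip x <;> cases c (g.perm.symm x) <;> simp [pow_succ] <;> ring

theorem cornerAct_surjective (g : Label d) (c : Fin d → Bool) :
    g.cornerAct (fun x => c (g.perm x) ^^ g.flip (g.perm x)) = c := by
  funext x
  simp [cornerAct]

theorem cornerAct_injective (g : Label d) : Function.Injective g.cornerAct := by
  intro c c' h
  funext x
  have := congrFun h (g.perm x)
  simpa [cornerAct] using this

theorem isGridIsometry_act (k : ℕ) (g : Label d) (u : Vertex d) :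
    IsGridIsometry fun v => u + act k g v := by
  intro x y
  rw [← Equiv.sum_comp g.perm]
  refine Finset.sum_congr rfl fun j _ => ?_
  simp only [act, Pi.add_apply, Equiv.symm_apply_apply]
  cases g.flip (g.perm j) <;> (simp; try ring)

/-- The first corner of the image of the Gray code. -/
def entry (g : Label d) : Fin d → Bool :=
  fun x => g.flip x ^^ (g.rev && decide ((g.perm.symm x : ℕ) + 1 = d))

/-- The last corner of the image of the Gray code. -/
def exit (g : Label d) : Fin d → Bool :=
  fun x => g.flip x ^^ (!g.rev && decide ((g.perm.symm x : ℕ) + 1 = d))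

theorem entry_reverse (g : Label d) : g.reverse.entry = g.exit := rfl

theorem exit_reverse (g : Label d) : g.reverse.exit = g.entry := by
  funext x; simp [reverse, entry, exit]; rfl

theorem entry_mul (g h : Label d) (x : Fin d) :
    (g * h).entry x =
      (g.flip x ^^ if g.rev then h.exit (g.perm.symm x) else h.entry (g.perm.symm x)) := by
  simp only [entry, exit, mul_flip, mul_rev, mul_perm_symm_apply]
  cases g.rev <;> simp <;> rfl

theorem exit_mul (g h : Label d) (x : Fin d) :
    (g * h).exit x =
      (g.flip x ^^ if g.rev then h.entry (g.perm.symm x) else h.exit (g.perm.symm x)) := by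
  simp only [entry, exit, mul_flip, mul_rev, mul_perm_symm_apply]
  cases g.rev <;> simp <;> rfl

/-- The index of the child that is visited at time `i`. -/
def childIndex (g : Label d) (i : ℕ) : ℕ := if g.rev then 2 ^ d - 1 - i else i

theorem childIndex_lt (g : Label d) {i : ℕ} (hi : i < 2 ^ d) : g.childIndex i < 2 ^ d := by
  unfold childIndex
  split <;> omega

theorem childIndex_childIndex (g : Label d) {i : ℕ} (hi : i < 2 ^ d) :
    g.childIndex (g.childIndex i) = i := by
  unfold childIndex
  split <;> omega

theorem childIndex_mul (g h : Label d) {i : ℕ} (hi : i < 2 ^ d) :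
    (g * h).childIndex i = h.childIndex (if g.rev then 2 ^ d - 1 - i else i) := by
  unfold childIndex
  rw [mul_rev]
  cases g.rev <;> cases h.rev <;> (simp; try omega)

end Label

/-! ### Schemes of generators -/

/-- The labels of the children of the cube with label `1`, the axes (before applying a label)
along which cubes are entered and left, and a bit that tells whether the end points of the curve
alternate between opposite corners of the corresponding facets. -/
structure Scheme (d : ℕ) where
  /-- the labels of the children -/
  gen : ℕ → Label d
  /-- the axis of the edge towards the first child -/
  inn : Fin d
  /-- the axis of the edge from the last child -/
  out : Fin d
  /-- whether the end points alternate between corners -/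
  twist : Bool

namespace Scheme

variable {d : ℕ} (S : Scheme d)

/-- The axis along which a cube with the given label is entered. -/
def inAxis (g : Label d) : Fin d := g.perm (if g.rev then S.out else S.inn)

/-- The axis along which a cube with the given label is left. -/
def outAxis (g : Label d) : Fin d := g.perm (if g.rev then S.inn else S.out)

theorem inAxis_reverse (g : Label d) : S.inAxis g.reverse = S.outAxis g := by
  rcases Bool.eq_false_or_eq_true g.rev with h1 | h1 <;> simp [inAxis, outAxis, Label.reverse, h1]

theorem outAxis_reverse (g : Label d) : S.outAxis g.reverse = S.inAxis g := by
  rcases Bool.eq_false_or_eq_true g.rev with h1 | h1 <;> simp [inAxis, outAxis, Label.reverse, h1]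

theorem inAxis_mul (g h : Label d) :
    S.inAxis (g * h) = g.perm (if g.rev then S.outAxis h else S.inAxis h) := by
  rcases Bool.eq_false_or_eq_true g.rev with h1 | h1 <;> 
    rcases Bool.eq_false_or_eq_true h.rev with h2 | h2 <;>
    simp [inAxis, outAxis, Label.mul_perm_apply, Label.mul_rev, h1, h2]

theorem outAxis_mul (g h : Label d) :
    S.outAxis (g * h) = g.perm (if g.rev then S.inAxis h else S.outAxis h) := by
  rcases Bool.eq_false_or_eq_true g.rev with h1 | h1 <;> 
    rcases Bool.eq_false_or_eq_true h.rev with h2 | h2 <;>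
    simp [inAxis, outAxis, Label.mul_perm_apply, Label.mul_rev, h1, h2]

/-- Cubes with the labels `g` and `g'` may follow each other on the curve. -/
structure Fits (g g' : Label d) : Prop where
  axis : S.outAxis g = S.inAxis g'
  corner : ∀ x, g'.entry x = (g.exit x ^^ decide (x = S.outAxis g))
  forth : ∀ x : Fin d, (x : ℕ) + 4 ≤ d → (g'.perm.symm (g.perm x) : ℕ) ≤ x + 1
  back : ∀ x : Fin d, (x : ℕ) + 4 ≤ d → (g.perm.symm (g'.perm x) : ℕ) ≤ x + 1

variable {S}

theorem Fits.mul_left {h h' : Label d} (H : S.Fits h h') (g : Label d) (hg : g.rev = false) :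
    S.Fits (g * h) (g * h') where
  axis := by simp [inAxis_mul, outAxis_mul, hg, H.axis]
  corner x := by
    simp only [Label.entry_mul, Label.exit_mul, outAxis_mul, hg, H.corner]
    simp [Equiv.symm_apply_eq]
  forth x hx := by
    simpa [Label.mul_perm_apply, Label.mul_perm_symm_apply] using H.forth x hx
  back x hx := by
    simpa [Label.mul_perm_apply, Label.mul_perm_symm_apply] using H.back x hx

theorem Fits.reverse {h h' : Label d} (H : S.Fits h h') : S.Fits h'.reverse h.reverse where
  axis := by rw [outAxis_reverse, inAxis_reverse, H.axis]
  corner x := by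
    rw [Label.entry_reverse, Label.exit_reverse, outAxis_reverse, H.corner, H.axis]
    simp
  forth := H.back
  back := H.forth

theorem _root_.CubeCurve.Label.mul_reverse (g h : Label d) :
    g.reverse * h = (g * h).reverse := by
  ext x
  · rfl
  · rfl
  · simp [Label.mul_rev, Label.reverse]

/-- A parent that is traversed backwards visits its children in the opposite order, so the pair is
swapped. -/
theorem Fits.mul_left_rev {h h' : Label d} (H : S.Fits h h') (g : Label d) (hg : g.rev = true) :
    S.Fits (g * h') (g * h) := by
  have h1 := (H.mul_left g.reverse (by simp [Label.reverse, hg])).reverse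
  rw [Label.mul_reverse, Label.mul_reverse] at h1
  simpa [Label.reverse] using h1

variable (S)

/-- The conditions under which a scheme produces hyperorthogonal curves. -/
structure Valid : Prop where
  three_le : 3 ≤ d
  inn_ne_out : S.inn ≠ S.out
  le_inn : d ≤ (S.inn : ℕ) + 2
  le_out : d ≤ (S.out : ℕ) + 2
  fits : ∀ i, i + 1 < 2 ^ d → S.Fits (S.gen i) (S.gen (i + 1))
  outAxis_gen : ∀ i, i + 1 < 2 ^ d → (S.outAxis (S.gen i) : ℕ) = ruler (i + 1)
  exit_gen : ∀ i, i + 1 < 2 ^ d →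
    (S.gen i).exit (S.outAxis (S.gen i)) = !gray d i (S.outAxis (S.gen i))
  inAxis_first : S.inAxis (S.gen 0) = S.inn
  entry_first : ∀ x, (S.gen 0).entry x = (S.twist && decide (x ≠ S.inn))
  perm_first_zero : ∀ x : Fin d, (x : ℕ) = 0 → (S.gen 0).perm x = S.out
  perm_first : ∀ x : Fin d, 1 ≤ (x : ℕ) → (x : ℕ) + 3 ≤ d → ((S.gen 0).perm x : ℕ) = d - 2 - x
  outAxis_last : S.outAxis (S.gen (2 ^ d - 1)) = S.out
  exit_last : ∀ x, (S.gen (2 ^ d - 1)).exit x =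
    (decide ((x : ℕ) + 1 = d) ^^ (S.twist && decide (x ≠ S.out)))
  perm_last_zero : ∀ x : Fin d, (x : ℕ) = 0 → (S.gen (2 ^ d - 1)).perm x = S.inn
  perm_last : ∀ x : Fin d, 1 ≤ (x : ℕ) → (x : ℕ) + 3 ≤ d →
    ((S.gen (2 ^ d - 1)).perm x : ℕ) = d - 2 - x

variable {S}

/-- The label of the last child, relative to the label of its parent. -/
def lastGen (S : Scheme d) (g : Label d) : Label d := S.gen (g.childIndex (2 ^ d - 1))

/-- The label of the first child, relative to the label of its parent. -/
def firstGen (S : Scheme d) (g : Label d) : Label d := S.gen (g.childIndex 0)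

theorem firstGen_reverse (g : Label d) : S.firstGen g.reverse = S.lastGen g := by
  unfold firstGen lastGen Label.childIndex Label.reverse
  cases h1 : g.rev <;> simp

/-- This is what lets an edge keep its axis under inflation. For a reversed parent the last child is
generator `0`, so the conditions on the first child apply. -/
theorem Valid.outAxis_lastGen (V : S.Valid) (g : Label d) :
    S.outAxis (g * S.lastGen g) = S.outAxis g := by
  rw [outAxis_mul]
  unfold lastGen Label.childIndex
  cases h : g.rev
  · rw [if_neg (by simp), if_neg (by simp), V.outAxis_last]; simp [outAxis, h]
  · simp [V.inAxis_first, outAxis, h]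

theorem Valid.exit_lastGen (V : S.Valid) (g : Label d) (x : Fin d) :
    (g * S.lastGen g).exit x = (g.exit x ^^ (S.twist && decide (x ≠ S.outAxis g))) := by
  rw [Label.exit_mul]
  unfold lastGen Label.childIndex
  cases h : g.rev
  · rw [if_neg (by simp), if_neg (by simp), V.exit_last]
    simp [outAxis, h, Label.exit, Equiv.symm_apply_eq]
  · simp [V.entry_first, outAxis, h, Label.exit, Equiv.symm_apply_eq]

/-- The statement about exits, applied to the reversed label. -/
theorem Valid.inAxis_firstGen (V : S.Valid) (g : Label d) :
    S.inAxis (g * S.firstGen g) = S.inAxis g := by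
  have := V.outAxis_lastGen g.reverse
  rw [← firstGen_reverse] at this
  rw [Label.mul_reverse, outAxis_reverse, outAxis_reverse] at this
  simpa [Label.reverse] using this

theorem Valid.entry_firstGen (V : S.Valid) (g : Label d) (x : Fin d) :
    (g * S.firstGen g).entry x = (g.entry x ^^ (S.twist && decide (x ≠ S.inAxis g))) := by
  have := V.exit_lastGen g.reverse x
  rw [← firstGen_reverse] at this
  rw [Label.mul_reverse, outAxis_reverse, Label.exit_reverse, Label.exit_reverse] at this
  simpa [Label.reverse] using this

/-- The permutation of a first or last child: slot `0` goes to `o`, the middle slots are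
reversed. -/
structure EndPerm (σ : Equiv.Perm (Fin d)) (o : Fin d) : Prop where
  zero : ∀ x : Fin d, (x : ℕ) = 0 → σ x = o
  middle : ∀ x : Fin d, 1 ≤ (x : ℕ) → (x : ℕ) + 3 ≤ d → (σ x : ℕ) = d - 2 - x

theorem Valid.endPerm_lastGen (V : S.Valid) (g : Label d) :
    EndPerm (S.lastGen g).perm (if g.rev then S.out else S.inn) := by
  unfold lastGen Label.childIndex
  cases h : g.rev
  · simpa using ⟨V.perm_last_zero, V.perm_last⟩
  · simpa using ⟨V.perm_first_zero, V.perm_first⟩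

theorem Valid.endPerm_firstGen (V : S.Valid) (g : Label d) :
    EndPerm (S.firstGen g).perm (if g.rev then S.inn else S.out) := by
  have := V.endPerm_lastGen g.reverse
  rw [← firstGen_reverse] at this
  simp only [Label.reverse] at this
  cases h : g.rev <;> simpa [firstGen, Label.childIndex, h] using this

/-- Reversing the middle slots turns a bound in one direction for the parents into a bound in the
other direction for the children. If the axis rose by two or more slots, its parent slots `y` and
`z` would satisfy `y ≥ d - 2 - x` and either `z = 0` or `z = d - 2 - u` with `u > x + 1`; both
contradict `y ≤ z + 1`. The slots `s'` and `o'` are excluded for `z`, since the former is shared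
with `s` and the latter is slot `0` of the child. -/
theorem EndPerm.symm_le {P P' σ σ' : Equiv.Perm (Fin d)} {o o' s s' : Fin d}
    (hσ : EndPerm σ o) (hσ' : EndPerm σ' o') (hs : P s = P' s') (hso : s ≠ o) (hso' : s' ≠ o')
    (hd : d ≤ (o : ℕ) + 2) (hos : d ≤ (s : ℕ) + 2) (hd' : d ≤ (o' : ℕ) + 2)
    (hos' : d ≤ (s' : ℕ) + 2)
    (hb : ∀ x : Fin d, (x : ℕ) + 4 ≤ d → (P.symm (P' x) : ℕ) ≤ x + 1)
    (x : Fin d) (hx : (x : ℕ) + 4 ≤ d) :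
    (σ'.symm (P'.symm (P (σ x))) : ℕ) ≤ x + 1 := by
  by_contra! hlt
  set y := σ x with hy
  set z := P'.symm (P y) with hz
  set u := σ'.symm z with hu
  have hzu : σ' u = z := by simp [hu]
  have hPz : P.symm (P' z) = y := by simp [hz]
  have hyle : d - 2 - x ≤ (y : ℕ) := by
    rcases Nat.eq_zero_or_pos (x : ℕ) with h0 | h0
    · rw [hσ.zero x h0] at hy; rw [hy]; omega
    · have := hσ.middle x h0 (by omega); rw [← hy] at this; omega
  have hys : y ≠ s := by
    rcases Nat.eq_zero_or_pos (x : ℕ) with h0 | h0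
    · rw [hy, hσ.zero x h0]; exact hso.symm
    · have := hσ.middle x h0 (by omega)
      rw [← hy] at this
      intro h; rw [h] at this; omega
  have hzs : z ≠ s' := by
    intro h
    rw [h, ← hs] at hPz
    simp at hPz
    exact hys hPz.symm
  have hzo : z ≠ o' := by
    intro h
    have h0 : 0 < d := by omega
    have : σ' ⟨0, h0⟩ = σ' u := by rw [hzu, h]; exact hσ'.zero _ rfl
    have := σ'.injective this
    rw [← this] at hlt
    simp at hlt
  have hz3 : (z : ℕ) + 3 ≤ d := by
    by_contra! h
    have h1 : (z : ℕ) ≠ s' := fun h => hzs (Fin.ext h)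
    have h2 : (z : ℕ) ≠ o' := fun h => hzo (Fin.ext h)
    have h3 : (s' : ℕ) ≠ o' := fun h => hso' (Fin.ext h)
    have := z.2; have := s'.2; have := o'.2
    omega
  rcases Nat.eq_zero_or_pos (z : ℕ) with h0 | h0
  · have := hb z (by omega)
    rw [hPz] at this
    omega
  · have hw : d - 2 - (z : ℕ) < d := by omega
    have h1 := hσ'.middle ⟨d - 2 - z, hw⟩ (by simp only; omega) (by simp only; omega)
    have h2 : σ' ⟨d - 2 - z, hw⟩ = σ' u := by
      rw [hzu]; apply Fin.ext; rw [h1]; simp only; omega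
    have h3 := σ'.injective h2
    have h4 : (u : ℕ) = d - 2 - z := by rw [← h3]
    have := hb z (by omega)
    rw [hPz] at this
    omega

/-- A twist flips the same coordinates on both sides, namely all but the common axis, so the corners
still match. -/
theorem Valid.fits_children (V : S.Valid) {g g' : Label d} (H : S.Fits g g') :
    S.Fits (g * S.lastGen g) (g' * S.firstGen g') where
  axis := by rw [V.outAxis_lastGen, V.inAxis_firstGen, H.axis]
  corner x := by
    rw [V.entry_firstGen, V.exit_lastGen, V.outAxis_lastGen, H.corner, H.axis]
    cases g.exit x <;> cases S.twist <;> cases decide (x = S.inAxis g') <;> simp_all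
  forth := by
    have hio := V.inn_ne_out
    refine EndPerm.symm_le (V.endPerm_lastGen g) (V.endPerm_firstGen g') H.axis ?_ ?_ ?_ ?_ ?_ ?_
      H.back
    · cases g.rev <;> simp [hio, hio.symm]
    · cases g'.rev <;> simp [hio, hio.symm]
    all_goals first | (cases g.rev <;> simp [V.le_inn, V.le_out]) |
      (cases g'.rev <;> simp [V.le_inn, V.le_out])
  back := by
    have hio := V.inn_ne_out
    refine EndPerm.symm_le (V.endPerm_firstGen g') (V.endPerm_lastGen g) H.axis.symm ?_ ?_ ?_ ?_
      ?_ ?_ H.forth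
    · cases g'.rev <;> simp [hio, hio.symm]
    · cases g.rev <;> simp [hio, hio.symm]
    all_goals first | (cases g.rev <;> simp [V.le_inn, V.le_out]) |
      (cases g'.rev <;> simp [V.le_inn, V.le_out])

end Scheme

end CubeCurve

/-! ### Labelled vertices of the approximating curves, and the step relation between consecutive
ones -/

namespace CubeCurve

namespace Scheme

variable {d : ℕ} (S : Scheme d)

/-- The `n`-th vertex, with its label, of the `k`-th approximation of the curve with label `g`. -/
def node : ℕ → Label d → ℕ → Vertex d × Label d
  | 0, g, _ => (0, g)
  | k + 1, g, n =>
    (2 • (node k g (n / 2 ^ d)).1 +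
        corner ((node k g (n / 2 ^ d)).2.cornerAct
          (gray d ((node k g (n / 2 ^ d)).2.childIndex (n % 2 ^ d)))),
      (node k g (n / 2 ^ d)).2 *
        S.gen ((node k g (n / 2 ^ d)).2.childIndex (n % 2 ^ d)))

theorem div_lt_of_lt_pow {k n : ℕ} (hn : n < 2 ^ (d * (k + 1))) : n / 2 ^ d < 2 ^ (d * k) := by
  rw [Nat.div_lt_iff_lt_mul (by positivity), ← pow_add]
  rwa [Nat.mul_succ] at hn

/-- The vertices with label `g` are the image under `g` of the vertices with label `1`. -/
theorem node_eq_act (k : ℕ) (g : Label d) (n : ℕ) (hn : n < 2 ^ (d * k)) :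
    S.node k g n =
      (g.act k (S.node k 1 (if g.rev then 2 ^ (d * k) - 1 - n else n)).1,
        g * (S.node k 1 (if g.rev then 2 ^ (d * k) - 1 - n else n)).2) := by
  induction k generalizing n with
  | zero =>
    simp only [node, Label.mul_one']
    congr 1
    funext x
    simp [Label.act]
  | succ k ih =>
    have hp : 0 < 2 ^ d := by positivity
    have hdiv := div_lt_of_lt_pow hn
    have hmod := Nat.mod_lt n hp
    have hN : 2 ^ (d * (k + 1)) = 2 ^ d * 2 ^ (d * k) := by rw [← pow_add]; congr 1; ring
    -- Reversing the order of traversal complements every digit in base `2 ^ d`.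
    have e0 : 2 ^ (d * (k + 1)) - 1 - n =
        (2 ^ d - 1 - n % 2 ^ d) + 2 ^ d * (2 ^ (d * k) - 1 - n / 2 ^ d) := by
      have := Nat.div_add_mod n (2 ^ d)
      have h3 : 2 ^ d * (n / 2 ^ d) + 2 ^ d ≤ 2 ^ d * 2 ^ (d * k) := by
        rw [← Nat.mul_succ]; exact Nat.mul_le_mul_left _ hdiv
      rw [Nat.mul_sub, Nat.mul_sub, mul_one, hN]
      omega
    have hlt : 2 ^ d - 1 - n % 2 ^ d < 2 ^ d := by omega
    have e1 : (if g.rev then 2 ^ (d * (k + 1)) - 1 - n else n) / 2 ^ d =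
        if g.rev then 2 ^ (d * k) - 1 - n / 2 ^ d else n / 2 ^ d := by
      split
      · rw [e0, Nat.add_mul_div_left _ _ hp, Nat.div_eq_of_lt hlt, zero_add]
      · rfl
    have e2 : (if g.rev then 2 ^ (d * (k + 1)) - 1 - n else n) % 2 ^ d =
        if g.rev then 2 ^ d - 1 - n % 2 ^ d else n % 2 ^ d := by
      split
      · rw [e0, Nat.add_mul_mod_self_left, Nat.mod_eq_of_lt hlt]
      · rfl
    simp only [node, e1, e2]
    rw [ih _ hdiv]
    set q := S.node k 1 (if g.rev then 2 ^ (d * k) - 1 - n / 2 ^ d else n / 2 ^ d)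
    simp only [Label.childIndex_mul _ _ hmod]
    rw [Label.act_succ, Label.cornerAct_mul, Label.mul_assoc']

/-- The curve of level `k + 1` consists of the curves of level `k` of the children. -/
theorem node_succ_eq (k : ℕ) (g : Label d) (n : ℕ) :
    S.node (k + 1) g n =
      (2 ^ k • (S.node 1 g (n / 2 ^ (d * k))).1 +
          (S.node k (S.node 1 g (n / 2 ^ (d * k))).2 (n % 2 ^ (d * k))).1,
        (S.node k (S.node 1 g (n / 2 ^ (d * k))).2 (n % 2 ^ (d * k))).2) := by
  induction k generalizing n with
  | zero => simp [node]
  | succ k ih =>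
    have h1 : n / 2 ^ d / 2 ^ (d * k) = n / 2 ^ (d * (k + 1)) := by
      rw [Nat.div_div_eq_div_mul, ← pow_add]; congr 2; ring
    have h2 : n / 2 ^ d % 2 ^ (d * k) = n % 2 ^ (d * (k + 1)) / 2 ^ d := by
      rw [Nat.mul_succ, add_comm, pow_add, Nat.mod_mul_right_div_self]
    have h3 : n % 2 ^ d = n % 2 ^ (d * (k + 1)) % 2 ^ d := by
      rw [Nat.mod_mod_of_dvd]
      exact pow_dvd_pow 2 (by rw [Nat.mul_succ]; omega)
    rw [node, ih, h1, h2, h3]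
    simp only [node]
    congr 1
    rw [smul_add, ← mul_smul, pow_succ', add_assoc]

theorem node_bounds (k : ℕ) (g : Label d) (n : ℕ) (x : Fin d) :
    0 ≤ (S.node k g n).1 x ∧ (S.node k g n).1 x < 2 ^ k := by
  induction k generalizing n with
  | zero => simp [node]
  | succ k ih =>
    have h := ih (n / 2 ^ d)
    simp only [node, Pi.add_apply, corner, nsmul_eq_mul, Nat.cast_ofNat, pow_succ]
    cases (S.node k g (n / 2 ^ d)).2.cornerAct
      (gray d ((S.node k g (n / 2 ^ d)).2.childIndex (n % 2 ^ d))) x <;> simp <;> omega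

theorem two_smul_add_corner_inj {v v' : Vertex d} {c c' : Fin d → Bool}
    (h : 2 • v + corner c = 2 • v' + corner c') : v = v' ∧ c = c' := by
  have key : ∀ x, v x = v' x ∧ c x = c' x := by
    intro x
    have := congrFun h x
    simp only [Pi.add_apply, corner, nsmul_eq_mul, Nat.cast_ofNat] at this
    cases hc : c x <;> cases hc' : c' x <;> simp [hc, hc'] at this ⊢ <;> omega
  exact ⟨funext fun x => (key x).1, funext fun x => (key x).2⟩

theorem node_injOn (k : ℕ) (g : Label d) {n n' : ℕ} (hn : n < 2 ^ (d * k))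
    (hn' : n' < 2 ^ (d * k)) (h : (S.node k g n).1 = (S.node k g n').1) : n = n' := by
  induction k generalizing n n' with
  | zero => simp at hn hn'; omega
  | succ k ih =>
    have hp : 0 < 2 ^ d := by positivity
    obtain ⟨h1, h2⟩ := two_smul_add_corner_inj h
    have h3 := ih (div_lt_of_lt_pow hn) (div_lt_of_lt_pow hn') h1
    rw [h3] at h2
    have h4 := gray_injOn (Label.childIndex_lt _ (Nat.mod_lt n hp))
      (Label.childIndex_lt _ (Nat.mod_lt n' hp)) (Label.cornerAct_injective _ h2)
    have h5 := congrArg (S.node k g (n' / 2 ^ d)).2.childIndex h4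
    rw [Label.childIndex_childIndex _ (Nat.mod_lt n hp),
      Label.childIndex_childIndex _ (Nat.mod_lt n' hp)] at h5
    rw [← Nat.div_add_mod n (2 ^ d), ← Nat.div_add_mod n' (2 ^ d), h3, h5]

theorem exists_child (k : ℕ) (g : Label d) (p : ℕ) (c : Fin d → Bool) :
    ∃ i < 2 ^ d, (S.node (k + 1) g (2 ^ d * p + i)).1 = 2 • (S.node k g p).1 + corner c := by
  have hp : 0 < 2 ^ d := by positivity
  set q := (S.node k g p).2 with hq
  obtain ⟨j, hj, hjc⟩ := gray_surj fun x => c (q.perm x) ^^ q.flip (q.perm x)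
  refine ⟨q.childIndex j, Label.childIndex_lt _ hj, ?_⟩
  have h1 : (2 ^ d * p + q.childIndex j) / 2 ^ d = p := by
    rw [Nat.mul_add_div hp, Nat.div_eq_of_lt (Label.childIndex_lt _ hj), add_zero]
  have h2 : (2 ^ d * p + q.childIndex j) % 2 ^ d = q.childIndex j := by
    rw [Nat.mul_add_mod, Nat.mod_eq_of_lt (Label.childIndex_lt _ hj)]
  rw [node, h1, h2, ← hq, Label.childIndex_childIndex _ hj, hjc, Label.cornerAct_surjective]

theorem exists_node_eq (k : ℕ) (g : Label d) (w : Vertex d) (hw : ∀ x, 0 ≤ w x ∧ w x < 2 ^ k) :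
    ∃ n < 2 ^ (d * k), (S.node k g n).1 = w := by
  induction k generalizing w with
  | zero =>
    refine ⟨0, by simp, funext fun x => ?_⟩
    have := hw x
    simp only [node, Pi.zero_apply]
    rw [pow_zero] at this
    omega
  | succ k ih =>
    obtain ⟨p, hp, hpw⟩ := ih (fun x => w x / 2) fun x => by
      have := hw x
      rw [pow_succ] at this
      omega
    obtain ⟨i, hi, hc⟩ := S.exists_child k g p fun x => decide (w x % 2 = 1)
    refine ⟨2 ^ d * p + i, ?_, ?_⟩
    · have : 2 ^ d * (p + 1) ≤ 2 ^ d * 2 ^ (d * k) := Nat.mul_le_mul_left _ hp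
      rw [Nat.mul_succ d, Nat.add_comm (d * k), pow_add]
      rw [Nat.mul_succ] at this
      omega
    · rw [hc, hpw]
      funext x
      simp only [Pi.add_apply, corner, nsmul_eq_mul, Nat.cast_ofNat]
      rcases Int.emod_two_eq_zero_or_one (w x) with h | h <;> simp [h] <;> omega

/-- The relation between consecutive labelled vertices. -/
structure Step (p q : Vertex d × Label d) : Prop where
  fits : S.Fits p.2 q.2
  vertex : q.1 = p.1 +
    Pi.single (S.outAxis p.2) (if p.2.exit (S.outAxis p.2) then (1 : ℤ) else -1)

variable {S}

theorem corner_flip {c c' : Fin d → Bool} {j : Fin d} (h : ∀ x, c' x = (c x ^^ decide (x = j))) :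
    corner c' = corner c + Pi.single j (if c j then (-1 : ℤ) else 1) := by
  funext x
  simp only [corner, Pi.add_apply, h]
  rcases eq_or_ne x j with rfl | hx
  · cases c x <;> simp
  · simp [hx]

theorem Valid.gray_succ_eq (V : S.Valid) {i : ℕ} (hi : i + 1 < 2 ^ d) (x : Fin d) :
    gray d (i + 1) x = (gray d i x ^^ decide (x = S.outAxis (S.gen i))) := by
  rw [gray_succ, ← V.outAxis_gen i hi]
  simp [Fin.ext_iff]

theorem _root_.CubeCurve.Label.exit_last_cornerAct (g : Label d) :
    g.cornerAct (gray d (g.childIndex (2 ^ d - 1))) = g.exit := by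
  funext x
  simp only [Label.cornerAct, Label.exit, Label.childIndex]
  cases g.rev
  · simp [gray_last]; rw [Bool.xor_comm]
  · simp [gray_zero]

theorem _root_.CubeCurve.Label.entry_first_cornerAct (g : Label d) :
    g.cornerAct (gray d (g.childIndex 0)) = g.entry := by
  funext x
  simp only [Label.cornerAct, Label.entry, Label.childIndex]
  cases g.rev
  · simp [gray_zero]
  · simp [gray_last]; rw [Bool.xor_comm]

/-- Consecutive children of one cube. -/
theorem Valid.step_siblings (V : S.Valid) (v : Vertex d) (g : Label d) {i : ℕ}
    (hi : i + 1 < 2 ^ d) :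
    S.Step
      (2 • v + corner (g.cornerAct (gray d (g.childIndex i))), g * S.gen (g.childIndex i))
      (2 • v + corner (g.cornerAct (gray d (g.childIndex (i + 1)))),
        g * S.gen (g.childIndex (i + 1))) := by
  rcases Bool.eq_false_or_eq_true g.rev with hg | hg
  · have hc1 : g.childIndex i = (2 ^ d - 1 - (i + 1)) + 1 := by
      simp only [Label.childIndex, hg, if_true]; omega
    have hc2 : g.childIndex (i + 1) = 2 ^ d - 1 - (i + 1) := by
      simp [Label.childIndex, hg]
    rw [hc1, hc2]
    -- In a reversed parent the step runs from generator `c + 1` back to generator `c`.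
    set c := 2 ^ d - 1 - (i + 1) with hc
    have hlt : c + 1 < 2 ^ d := by omega
    have F := V.fits c hlt
    refine ⟨F.mul_left_rev g hg, ?_⟩
    simp only
    have ho : S.outAxis (g * S.gen (c + 1)) = g.perm (S.outAxis (S.gen c)) := by
      simp [outAxis_mul, hg, F.axis]
    rw [ho, Label.exit_mul]
    set j := S.outAxis (S.gen c) with hj
    have he : (S.gen (c + 1)).entry j = gray d c j := by
      rw [F.corner, ← hj, hj, V.exit_gen c hlt]; simp
    rw [corner_flip (c := g.cornerAct (gray d (c + 1))) (c' := g.cornerAct (gray d c))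
      (j := g.perm j), add_assoc]
    · congr 2
      simp only [hg, if_true, Equiv.symm_apply_apply, he, Label.cornerAct, V.gray_succ_eq hlt, ← hj]
      cases gray d c j <;> cases g.flip (g.perm j) <;> simp
    · intro x
      simp only [Label.cornerAct, V.gray_succ_eq hlt, ← hj, Equiv.symm_apply_eq]
      cases gray d c (g.perm.symm x) <;> cases g.flip x <;> simp
  · have hc1 : g.childIndex i = i := by simp [Label.childIndex, hg]
    have hc2 : g.childIndex (i + 1) = i + 1 := by simp [Label.childIndex, hg]
    rw [hc1, hc2]
    have F := V.fits i hi
    refine ⟨F.mul_left g hg, ?_⟩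
    simp only
    have ho : S.outAxis (g * S.gen i) = g.perm (S.outAxis (S.gen i)) := by
      simp [outAxis_mul, hg]
    rw [ho, Label.exit_mul]
    set j := S.outAxis (S.gen i) with hj
    have he : (S.gen i).exit j = !gray d i j := V.exit_gen i hi
    rw [corner_flip (c := g.cornerAct (gray d i)) (c' := g.cornerAct (gray d (i + 1)))
      (j := g.perm j), add_assoc]
    · congr 2
      simp only [hg, Equiv.symm_apply_apply, he, Label.cornerAct]
      cases gray d i j <;> cases g.flip (g.perm j) <;> simp
    · intro x
      simp only [Label.cornerAct, V.gray_succ_eq hi, ← hj, Equiv.symm_apply_eq]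
      cases gray d i (g.perm.symm x) <;> cases g.flip x <;> simp

/-- The last child of a cube and the first child of the next cube. -/
theorem Valid.step_cousins (V : S.Valid) {p q : Vertex d × Label d} (H : S.Step p q) :
    S.Step
      (2 • p.1 + corner (p.2.cornerAct (gray d (p.2.childIndex (2 ^ d - 1)))),
        p.2 * S.gen (p.2.childIndex (2 ^ d - 1)))
      (2 • q.1 + corner (q.2.cornerAct (gray d (q.2.childIndex 0))),
        q.2 * S.gen (q.2.childIndex 0)) := by
  refine ⟨V.fits_children H.fits, ?_⟩
  have ho : S.outAxis (p.2 * S.gen (p.2.childIndex (2 ^ d - 1))) = S.outAxis p.2 :=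
    V.outAxis_lastGen p.2
  have he : (p.2 * S.gen (p.2.childIndex (2 ^ d - 1))).exit (S.outAxis p.2) =
      p.2.exit (S.outAxis p.2) := by
    have := V.exit_lastGen p.2 (S.outAxis p.2)
    rw [lastGen] at this
    simpa using this
  simp only [ho, he, Label.exit_last_cornerAct, Label.entry_first_cornerAct]
  -- With `e` the parent edge, doubling contributes `2e` and the change from exit to entry corner
  -- contributes `-e`, which leaves the single edge `e`.
  rw [corner_flip H.fits.corner, H.vertex]
  set j := S.outAxis p.2
  cases p.2.exit j <;>
    simp only [Bool.false_eq_true, if_true, if_false, Pi.single_neg] <;> module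

theorem Valid.step_node (V : S.Valid) (k : ℕ) (g : Label d) (n : ℕ) (hn : n + 1 < 2 ^ (d * k)) :
    S.Step (S.node k g n) (S.node k g (n + 1)) := by
  induction k generalizing n with
  | zero => simp at hn
  | succ k ih =>
    have hp : 0 < 2 ^ d := by positivity
    have hmod := Nat.mod_lt n hp
    have hdm := Nat.div_add_mod n (2 ^ d)
    rcases Nat.lt_or_ge (n % 2 ^ d + 1) (2 ^ d) with h | h
    · have h1 : (n + 1) / 2 ^ d = n / 2 ^ d := by
        rw [Nat.div_eq_iff hp, Nat.mul_comm]; omega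
      have h2 : (n + 1) % 2 ^ d = n % 2 ^ d + 1 := by
        rw [Nat.add_mod_of_add_mod_lt] <;> rw [Nat.mod_eq_of_lt (show 1 < 2 ^ d by omega)]
        exact h
      simp only [node, h1, h2]
      exact V.step_siblings _ _ h
    · have hm : n % 2 ^ d = 2 ^ d - 1 := by omega
      have hn1 : n + 1 = 2 ^ d * (n / 2 ^ d + 1) := by rw [Nat.mul_succ]; omega
      have h1 : (n + 1) / 2 ^ d = n / 2 ^ d + 1 := by
        rw [hn1, Nat.mul_div_cancel_left _ hp]
      have h2 : (n + 1) % 2 ^ d = 0 := by rw [hn1, Nat.mul_mod_right]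
      have h3 := div_lt_of_lt_pow hn
      rw [h1] at h3
      simp only [node, h1, h2, hm]
      exact V.step_cousins (ih _ h3)

end Scheme

end CubeCurve

/-! ### Approximating curves: inflation, well-foldedness and self-similarity -/

namespace CubeCurve

theorem map_range_mul {α : Type*} (f : ℕ → α) (M N : ℕ) :
    (List.range (M * N)).map f =
      ((List.range N).map fun p => (List.range M).map fun i => f (M * p + i)).flatten := by
  induction N with
  | zero => simp
  | succ N ih =>
    rw [Nat.mul_succ, List.range_add, List.map_append, ih, List.range_succ]
    simp [Function.comp_def]

theorem isGridCurve_map_range {d N : ℕ} (hN : 0 < N) (f : ℕ → Vertex d)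
    (hinj : ∀ n n', n < N → n' < N → f n = f n' → n = n')
    (hstep : ∀ n, n + 1 < N → ∃ e : Direction d, f (n + 1) = f n + e.vec) :
    IsGridCurve ((List.range N).map f) := by
  refine ⟨?_, exists_gridPath_of_isChain _ (by simp; omega) ?_⟩
  · refine List.Nodup.map_on (fun n hn n' hn' h => ?_) List.nodup_range
    exact hinj n n' (List.mem_range.1 hn) (List.mem_range.1 hn') h
  · rw [List.isChain_iff_getElem]
    intro i hi
    simp only [List.length_map, List.length_range] at hi
    simpa using hstep i hi

theorem exists_vec_eq {d : ℕ} (j : Fin d) (b : Bool) :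
    ∃ e : Direction d, e.vec = Pi.single j (if b then (1 : ℤ) else -1) := by
  cases b
  · exact ⟨(j, -1), by simp [Direction.vec]⟩
  · exact ⟨(j, 1), by simp [Direction.vec]⟩

namespace Scheme

variable {d : ℕ} (S : Scheme d)

/-- The `k`-th approximating curve. -/
def approx (k : ℕ) : List (Vertex d) := (List.range (2 ^ (d * k))).map fun n => (S.node k 1 n).1

/-- The curve through the children of the `p`-th vertex of the `k`-th approximating curve. -/
def childCurve (k p : ℕ) : List (Vertex d) :=
  (List.range (2 ^ d)).map fun i => (S.node (k + 1) 1 (2 ^ d * p + i)).1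

theorem mul_add_lt {k p i : ℕ} (hp : p < 2 ^ (d * k)) (hi : i < 2 ^ d) :
    2 ^ d * p + i < 2 ^ (d * (k + 1)) := by
  have : 2 ^ d * (p + 1) ≤ 2 ^ d * 2 ^ (d * k) := Nat.mul_le_mul_left _ hp
  rw [Nat.mul_succ d, Nat.add_comm (d * k), pow_add]
  rw [Nat.mul_succ] at this
  omega

theorem node_child (k p i : ℕ) (hi : i < 2 ^ d) (g : Label d) :
    (S.node (k + 1) g (2 ^ d * p + i)).1 = 2 • (S.node k g p).1 +
      corner ((S.node k g p).2.cornerAct (gray d ((S.node k g p).2.childIndex i))) := by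
  have hM : 0 < 2 ^ d := by positivity
  rw [node, Nat.mul_add_div hM, Nat.div_eq_of_lt hi, Nat.mul_add_mod, Nat.mod_eq_of_lt hi, add_zero]

theorem approx_succ (k : ℕ) :
    S.approx (k + 1) = ((List.range (2 ^ (d * k))).map (S.childCurve k)).flatten := by
  unfold approx childCurve
  rw [show 2 ^ (d * (k + 1)) = 2 ^ d * 2 ^ (d * k) by rw [← pow_add]; congr 1; ring,
    map_range_mul]

variable {S}

theorem Step.exists_vec {p q : Vertex d × Label d} (h : S.Step p q) :
    ∃ e : Direction d, q.1 = p.1 + e.vec := by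
  obtain ⟨e, he⟩ := exists_vec_eq (S.outAxis p.2) (p.2.exit (S.outAxis p.2))
  exact ⟨e, by rw [he]; exact h.vertex⟩

theorem Valid.isGridCurve_approx (V : S.Valid) (k : ℕ) : IsGridCurve (S.approx k) :=
  isGridCurve_map_range (by positivity) _ (fun _ _ hn hn' h => S.node_injOn k 1 hn hn' h)
    fun n hn => (V.step_node k 1 n hn).exists_vec

theorem Valid.isKCurve_approx (V : S.Valid) (k : ℕ) : IsKCurve k 0 (S.approx k) := by
  refine ⟨V.isGridCurve_approx k, fun w => ?_⟩
  simp only [approx, List.mem_map, List.mem_range, Pi.zero_apply, zero_add]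
  constructor
  · rintro ⟨n, -, rfl⟩
    exact S.node_bounds k 1 n
  · intro h
    obtain ⟨n, hn, h⟩ := S.exists_node_eq k 1 w h
    exact ⟨n, hn, h⟩

theorem Valid.isKCurve_childCurve (V : S.Valid) (k p : ℕ) (hp : p < 2 ^ (d * k)) :
    IsKCurve 1 (2 • (S.node k 1 p).1) (S.childCurve k p) := by
  refine ⟨isGridCurve_map_range (by positivity) _ ?_ ?_, fun w => ?_⟩
  · intro i i' hi hi' h
    have := S.node_injOn (k + 1) 1 (mul_add_lt hp hi) (mul_add_lt hp hi') h
    omega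
  · intro i hi
    exact (V.step_node (k + 1) 1 (2 ^ d * p + i) (mul_add_lt (i := i + 1) hp hi)).exists_vec
  · simp only [childCurve, List.mem_map, List.mem_range]
    constructor
    · rintro ⟨i, hi, rfl⟩ j
      rw [node_child _ _ _ _ hi]
      simp only [Pi.add_apply, corner]
      cases (S.node k 1 p).2.cornerAct (gray d ((S.node k 1 p).2.childIndex i)) j <;> simp
    · intro h
      obtain ⟨i, hi, hc⟩ := S.exists_child k 1 p
        fun x => decide (w x = (2 • (S.node k 1 p).1) x + 1)
      refine ⟨i, hi, ?_⟩
      rw [hc]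
      funext x
      have := h x
      rw [pow_one] at this
      simp only [Pi.add_apply, corner]
      rcases eq_or_ne (w x) ((2 • (S.node k 1 p).1) x + 1) with h1 | h1
      · simp [h1]
      · simp only [h1, decide_false, Bool.toNat_false, Nat.cast_zero]
        omega

theorem Valid.isInflation (V : S.Valid) (k : ℕ) :
    IsInflation (S.approx k) ((List.range (2 ^ (d * k))).map (S.childCurve k))
      (S.approx (k + 1)) where
  children := by
    rw [approx, List.forall₂_map_left_iff, List.forall₂_map_right_iff, List.forall₂_same]
    exact fun p hp => V.isKCurve_childCurve k p (List.mem_range.1 hp)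
  edges := by
    rw [List.isChain_iff_getElem]
    intro p hp
    simp only [approx, List.length_zip, List.length_map, List.length_range, min_self] at hp
    have hM : 0 < 2 ^ d := by positivity
    have h1 : (S.childCurve k p).getLast? = some (S.node (k + 1) 1 (2 ^ d * p + (2 ^ d - 1))).1 := by
      simp [childCurve, List.getLast?_range]
    have h2 : (S.childCurve k (p + 1)).head? = some (S.node (k + 1) 1 (2 ^ d * (p + 1) + 0)).1 := by
      simp [childCurve, List.head?_range]
    refine ⟨(S.node (k + 1) 1 (2 ^ d * p + (2 ^ d - 1))).1, (S.node (k + 1) 1 (2 ^ d * (p + 1) + 0)).1,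
      by simpa [approx] using h1, by simpa [approx] using h2, ?_⟩
    have H := V.step_node k 1 p hp
    have H' := (V.step_cousins H).vertex
    rw [node_child _ k (p + 1) 0 hM, node_child _ k p (2 ^ d - 1) (by omega)]
    have ho : S.outAxis ((S.node k 1 p).2 * S.gen ((S.node k 1 p).2.childIndex (2 ^ d - 1))) =
        S.outAxis (S.node k 1 p).2 := V.outAxis_lastGen _
    have he : ((S.node k 1 p).2 * S.gen ((S.node k 1 p).2.childIndex (2 ^ d - 1))).exit
        (S.outAxis (S.node k 1 p).2) = (S.node k 1 p).2.exit (S.outAxis (S.node k 1 p).2) := by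
      have := V.exit_lastGen (S.node k 1 p).2 (S.outAxis (S.node k 1 p).2)
      rw [lastGen] at this
      simpa using this
    simp only [ho, he] at H'
    simp only [approx, List.getElem_zip, List.getElem_map, List.getElem_range]
    rw [H', H.vertex]
    abel
  concat := S.approx_succ k
  curve := V.isGridCurve_approx (k + 1)

theorem childIndex_map_range {α : Type*} (g : Label d) (f : ℕ → α) :
    (List.range (2 ^ d)).map (fun i => f (g.childIndex i)) = (List.range (2 ^ d)).map f ∨
    (List.range (2 ^ d)).map (fun i => f (g.childIndex i)) =
      ((List.range (2 ^ d)).map f).reverse := by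
  rcases Bool.eq_false_or_eq_true g.rev with hg | hg
  · right
    apply List.ext_getElem <;> simp [Label.childIndex, hg]
  · left
    simp [Label.childIndex, hg]

theorem isIsometricImage_childCurve (k p : ℕ) :
    IsIsometricImage (gridPath 0 (grayCode d)) (S.childCurve k p) := by
  refine ⟨_, Label.isGridIsometry_act 1 (S.node k 1 p).2 (2 • (S.node k 1 p).1), ?_⟩
  rw [gridPath_grayCode, List.map_map]
  have : S.childCurve k p = (List.range (2 ^ d)).map fun i =>
      ((fun v => 2 • (S.node k 1 p).1 + Label.act 1 (S.node k 1 p).2 v) ∘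
        fun i => corner (gray d i)) ((S.node k 1 p).2.childIndex i) := by
    refine List.map_congr_left fun i hi => ?_
    rw [node_child _ _ _ _ (List.mem_range.1 hi)]
    simp [Label.act_one_corner]
  rw [this]
  exact childIndex_map_range _ _

theorem approx_zero : S.approx 0 = [0] := by simp [approx, node]

theorem Valid.wellFolded (V : S.Valid) (k : ℕ) : WellFolded (S.approx k) := by
  induction k with
  | zero => rw [approx_zero]; exact .single 0
  | succ k ih =>
    refine .inflate _ _ _ ih (V.isInflation k) fun C hC => ?_
    obtain ⟨p, -, rfl⟩ := List.mem_map.1 hC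
    exact isIsometricImage_childCurve k p

/-- The blocks are the level-`k` curves of the children of the initial cube; each is an image of the
curve with label `1`, read backwards if the child's label says so. -/
theorem isConcatOfCopies (k : ℕ) : IsConcatOfCopies (S.approx k) (S.approx (k + 1)) := by
  refine ⟨(List.range (2 ^ d)).map fun i => (List.range (2 ^ (d * k))).map fun n =>
    (S.node (k + 1) 1 (2 ^ (d * k) * i + n)).1, by simp, fun C hC => ?_, ?_⟩
  · obtain ⟨i, -, rfl⟩ := List.mem_map.1 hC
    set q := S.node 1 1 i with hq
    refine ⟨_, Label.isGridIsometry_act k q.2 (2 ^ k • q.1), ?_⟩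
    have hN : 0 < 2 ^ (d * k) := by positivity
    have key : (List.range (2 ^ (d * k))).map (fun n =>
        (S.node (k + 1) 1 (2 ^ (d * k) * i + n)).1) =
        (List.range (2 ^ (d * k))).map fun n => 2 ^ k • q.1 +
          Label.act k q.2 (S.node k 1 (if q.2.rev then 2 ^ (d * k) - 1 - n else n)).1 := by
      refine List.map_congr_left fun n hn => ?_
      have hn' := List.mem_range.1 hn
      rw [node_succ_eq, Nat.mul_add_div hN, Nat.div_eq_of_lt hn', Nat.mul_add_mod,
        Nat.mod_eq_of_lt hn', add_zero, ← hq, node_eq_act _ _ _ _ hn']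
    rw [key]
    rcases Bool.eq_false_or_eq_true q.2.rev with h | h
    · right
      apply List.ext_getElem <;> simp [approx, h]
    · left
      simp [approx, h]
  · rw [approx, Nat.mul_succ, pow_add]
    exact map_range_mul (fun n => (S.node (k + 1) 1 n).1) _ _

end Scheme

end CubeCurve

/-! ### Hyperorthogonality: counting axes in windows of `2 ^ n` edges -/

namespace CubeCurve

/-- Distinct multiples of `2 ^ m` are at least `2 ^ m` apart. -/
theorem ruler_lt_of_near {n m e s : ℕ} (hs : 2 ^ n ∣ s) (hm : m ≤ n) (he0 : e ≠ 0) (hne : e ≠ s)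
    (h1 : e < s + 2 ^ m) (h2 : s < e + 2 ^ m) : ruler e < m := by
  by_contra! h
  have hd := (two_pow_dvd_iff_le_ruler he0).2 h
  have hs' : 2 ^ m ∣ s := (pow_dvd_pow 2 hm).trans hs
  rcases Nat.lt_or_ge e s with hlt | hge
  · have := Nat.le_of_dvd (by omega) (Nat.dvd_sub hs' hd)
    omega
  · have := Nat.le_of_dvd (by omega) (Nat.dvd_sub hd hs')
    omega

theorem ruler_eq_of_dvd {e y : ℕ} (he : e ≠ 0) (h1 : 2 ^ y ∣ e) (h2 : ¬ 2 ^ (y + 1) ∣ e) :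
    ruler e = y := by
  rw [two_pow_dvd_iff_le_ruler he] at h1 h2
  omega

theorem not_pow_succ_dvd_pow (y : ℕ) : ¬ 2 ^ (y + 1) ∣ 2 ^ y := by
  rw [Nat.pow_dvd_pow_iff_le_right (by norm_num)]
  omega

theorem ruler_add_pow {n s y : ℕ} (hs : 2 ^ n ∣ s) (hy : y < n) : ruler (s + 2 ^ y) = y := by
  refine ruler_eq_of_dvd (by positivity) ?_ ?_
  · exact dvd_add ((pow_dvd_pow 2 hy.le).trans hs) dvd_rfl
  · rw [Nat.dvd_add_right ((pow_dvd_pow 2 hy).trans hs)]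
    exact not_pow_succ_dvd_pow y

theorem ruler_sub_pow {n s y : ℕ} (hs : 2 ^ n ∣ s) (hy : y < n) (hlt : 2 ^ y < s) :
    ruler (s - 2 ^ y) = y := by
  refine ruler_eq_of_dvd (by omega) ?_ ?_
  · exact Nat.dvd_sub ((pow_dvd_pow 2 hy.le).trans hs) dvd_rfl
  · rw [Nat.dvd_sub_iff_right hlt.le ((pow_dvd_pow 2 hy).trans hs)]
    exact not_pow_succ_dvd_pow y

/-- Here `σ` belongs to the longer side of the window and `τ` to the shorter one. A slot `y` of `τ`
with `y + 1 < n` satisfies `y + 4 ≤ d`, so `h4` moves it to a slot of `σ` below `n`, and the shorter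
side adds no axis. -/
theorem card_image_of_cover {d n : ℕ} (hn : n + 2 ≤ d) (c : ℕ → Fin d) (W : Finset ℕ) {s : ℕ}
    (hs : s ∈ W) (σ τ : Equiv.Perm (Fin d))
    (h1 : ∀ y : Fin d, (y : ℕ) < n → ∃ e ∈ W, c e = σ y)
    (h2 : ∀ e ∈ W, e ≠ s → (∃ y : Fin d, (y : ℕ) < n ∧ c e = σ y) ∨
      ∃ y : Fin d, (y : ℕ) + 1 < n ∧ c e = τ y)
    (h3 : ∀ y : Fin d, (y : ℕ) < n → c s ≠ σ y)
    (h4 : ∀ x : Fin d, (x : ℕ) + 4 ≤ d → (σ.symm (τ x) : ℕ) ≤ x + 1) :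
    (W.image c).card = n + 1 := by
  have himg : W.image c =
      insert (c s) ((Finset.univ.filter fun y : Fin d => (y : ℕ) < n).image σ) := by
    ext a
    simp only [Finset.mem_image, Finset.mem_insert, Finset.mem_filter, Finset.mem_univ, true_and]
    constructor
    · rintro ⟨e, he, rfl⟩
      rcases eq_or_ne e s with rfl | hne
      · exact .inl rfl
      · right
        rcases h2 e he hne with ⟨y, hy, h⟩ | ⟨y, hy, h⟩
        · exact ⟨y, hy, h.symm⟩
        · refine ⟨σ.symm (τ y), ?_, by simp [h]⟩
          have := h4 y (by omega)
          omega
    · rintro (rfl | ⟨y, hy, rfl⟩)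
      · exact ⟨s, hs, rfl⟩
      · exact h1 y hy
  rw [himg, Finset.card_insert_of_notMem, Finset.card_image_of_injective _ σ.injective,
    Fin.card_filter_val_lt, min_eq_right (by omega)]
  simp only [Finset.mem_image, Finset.mem_filter, Finset.mem_univ, true_and, not_exists, not_and]
  exact fun y hy h => h3 y hy h.symm

theorem card_image_window {d n : ℕ} (hn : n + 2 ≤ d) (c : ℕ → Fin d) (P s : ℕ)
    (hs : 2 ^ n ∣ s) (hPs : P < s) (hsP : s ≤ P + 2 ^ n) (σ τ : Equiv.Perm (Fin d))
    (hσ : ∀ e, P < e → e < s → ∀ y : Fin d, (y : ℕ) = ruler e → c e = σ y)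
    (hτ : ∀ e, s < e → e ≤ P + 2 ^ n → ∀ y : Fin d, (y : ℕ) = ruler e → c e = τ y)
    (hsσ : ∀ y : Fin d, (y : ℕ) < n → c s ≠ σ y) (hsτ : ∀ y : Fin d, (y : ℕ) < n → c s ≠ τ y)
    (forth : ∀ x : Fin d, (x : ℕ) + 4 ≤ d → (τ.symm (σ x) : ℕ) ≤ x + 1)
    (back : ∀ x : Fin d, (x : ℕ) + 4 ≤ d → (σ.symm (τ x) : ℕ) ≤ x + 1) :
    ((Finset.Ioc P (P + 2 ^ n)).image c).card = n + 1 := by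
  have hsW : s ∈ Finset.Ioc P (P + 2 ^ n) := Finset.mem_Ioc.2 ⟨hPs, hsP⟩
  have hpow : ∀ y, y < n → 2 ^ (y + 1) ≤ 2 ^ n := fun y hy =>
    Nat.pow_le_pow_right (by norm_num) hy
  -- There are `s - P - 1` edges before `s`; the case distinction is which side of `s` is long
  -- enough to contain `s ± 2 ^ y` for all `y < n`.
  rcases Nat.lt_or_ge (2 * (s - P - 1)) (2 ^ n) with hside | hside
  · refine card_image_of_cover hn c _ hsW τ σ (fun y hy => ?_) (fun e he hne => ?_) hsτ forth
    · have h1 := hpow y hy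
      have hp : 0 < 2 ^ (y : ℕ) := by positivity
      rw [pow_succ] at h1
      refine ⟨s + 2 ^ (y : ℕ), Finset.mem_Ioc.2 ⟨by omega, by omega⟩, ?_⟩
      exact hτ _ (by omega) (by omega) y (ruler_add_pow hs hy).symm
    · rw [Finset.mem_Ioc] at he
      rcases lt_or_gt_of_ne hne with h | h
      · right
        have hn0 : n ≠ 0 := by rintro rfl; simp at hside; omega
        obtain ⟨m, rfl⟩ := Nat.exists_eq_succ_of_ne_zero hn0
        have hr : ruler e < m := by
          rw [Nat.succ_eq_add_one, pow_succ] at hside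
          exact ruler_lt_of_near hs (by omega) (by omega) hne (by omega) (by omega)
        exact ⟨⟨ruler e, by omega⟩, by simp only; omega, hσ e he.1 h _ rfl⟩
      · left
        have hr : ruler e < n :=
          ruler_lt_of_near hs le_rfl (by omega) hne (by omega) (by omega)
        exact ⟨⟨ruler e, by omega⟩, hr, hτ e h he.2 _ rfl⟩
  · refine card_image_of_cover hn c _ hsW σ τ (fun y hy => ?_) (fun e he hne => ?_) hsσ back
    · have h1 := hpow y hy
      have hp : 0 < 2 ^ (y : ℕ) := by positivity
      rw [pow_succ] at h1
      refine ⟨s - 2 ^ (y : ℕ), Finset.mem_Ioc.2 ⟨by omega, by omega⟩, ?_⟩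
      exact hσ _ (by omega) (by omega) y (ruler_sub_pow hs hy (by omega)).symm
    · rw [Finset.mem_Ioc] at he
      rcases lt_or_gt_of_ne hne with h | h
      · left
        have hr : ruler e < n :=
          ruler_lt_of_near hs le_rfl (by omega) hne (by omega) (by omega)
        exact ⟨⟨ruler e, by omega⟩, hr, hσ e he.1 h _ rfl⟩
      · right
        have hn0 : n ≠ 0 := by rintro rfl; simp at hside; omega
        obtain ⟨m, rfl⟩ := Nat.exists_eq_succ_of_ne_zero hn0
        have hr : ruler e < m := by
          rw [Nat.succ_eq_add_one, pow_succ] at hside he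
          exact ruler_lt_of_near hs (by omega) (by omega) hne (by omega) (by omega)
        exact ⟨⟨ruler e, by omega⟩, by simp only; omega, hτ e h he.2 _ rfl⟩

namespace Scheme

variable {d : ℕ} {S : Scheme d}

theorem ruler_mod {e : ℕ} (h : e % 2 ^ d ≠ 0) : ruler (e % 2 ^ d) = ruler e := by
  have he : e ≠ 0 := by rintro rfl; simp at h
  have hlt := ruler_lt h (Nat.mod_lt e (by positivity))
  have key : ∀ m ≤ d, (2 ^ m ∣ e % 2 ^ d ↔ 2 ^ m ∣ e) := fun m hm =>
    Nat.dvd_mod_iff (pow_dvd_pow 2 hm)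
  refine (ruler_eq_of_dvd he ?_ ?_).symm
  · rw [← key _ hlt.le, two_pow_dvd_iff_le_ruler h]
  · rw [← key _ hlt, two_pow_dvd_iff_le_ruler h]
    omega

/-- The axis of the `e`-th edge, counted from one, of an approximating curve. -/
def edgeAxis (S : Scheme d) (k e : ℕ) : Fin d := S.outAxis (S.node k 1 (e - 1)).2

/-- Reversal does not affect which slot is used, because `ruler (2 ^ d - e) = ruler e`. -/
theorem Valid.edgeAxis_inner (V : S.Valid) (k e : ℕ) (he : e % 2 ^ d ≠ 0) (y : Fin d)
    (hy : (y : ℕ) = ruler e) :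
    S.edgeAxis (k + 1) e = (S.node k 1 (e / 2 ^ d)).2.perm y := by
  have hM : 0 < 2 ^ d := by positivity
  have hlt := Nat.mod_lt e hM
  have hdm := Nat.div_add_mod e (2 ^ d)
  have h0 : e - 1 = 2 ^ d * (e / 2 ^ d) + (e % 2 ^ d - 1) := by omega
  have h1 : (e - 1) / 2 ^ d = e / 2 ^ d := by
    rw [h0, Nat.mul_add_div hM,
      Nat.div_eq_of_lt (show e % 2 ^ d - 1 < 2 ^ d by omega), add_zero]
  have h2 : (e - 1) % 2 ^ d = e % 2 ^ d - 1 := by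
    rw [h0, Nat.mul_add_mod, Nat.mod_eq_of_lt (by omega)]
  simp only [edgeAxis, node, h1, h2]
  set g := (S.node k 1 (e / 2 ^ d)).2
  rw [outAxis_mul]
  congr 1
  rw [← ruler_mod he] at hy
  rcases Bool.eq_false_or_eq_true g.rev with hg | hg
  · have hc : g.childIndex (e % 2 ^ d - 1) = 2 ^ d - e % 2 ^ d - 1 + 1 := by
      simp only [Label.childIndex, hg, if_true]; omega
    rw [hc, if_pos hg, ← (V.fits _ (by omega)).axis]
    apply Fin.ext
    rw [V.outAxis_gen _ (by omega), hy, ← ruler_sub he hlt]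
    congr 1
    omega
  · have hc : g.childIndex (e % 2 ^ d - 1) = e % 2 ^ d - 1 := by
      simp [Label.childIndex, hg]
    rw [hc, if_neg (by simp [hg])]
    apply Fin.ext
    rw [V.outAxis_gen _ (by omega), hy]
    congr 1
    omega

theorem Valid.edgeAxis_outer (V : S.Valid) (k q : ℕ) :
    S.edgeAxis (k + 1) (2 ^ d * (q + 1)) = S.outAxis (S.node k 1 q).2 := by
  have hM : 0 < 2 ^ d := by positivity
  have h0 : 2 ^ d * (q + 1) - 1 = 2 ^ d * q + (2 ^ d - 1) := by rw [Nat.mul_succ]; omega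
  have h1 : (2 ^ d * (q + 1) - 1) / 2 ^ d = q := by
    rw [h0, Nat.mul_add_div hM, Nat.div_eq_of_lt (by omega), add_zero]
  have h2 : (2 ^ d * (q + 1) - 1) % 2 ^ d = 2 ^ d - 1 := by
    rw [h0, Nat.mul_add_mod, Nat.mod_eq_of_lt (by omega)]
  simp only [edgeAxis, node, h1, h2]
  exact V.outAxis_lastGen _

theorem Valid.card_image_edgeAxis (V : S.Valid) (k n P : ℕ) (hn : n + 2 ≤ d)
    (hP : P + 2 ^ n < 2 ^ (d * (k + 1))) :
    ((Finset.Ioc P (P + 2 ^ n)).image (S.edgeAxis (k + 1))).card = n + 1 := by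
  have hM : 0 < 2 ^ d := by positivity
  have hL : 0 < 2 ^ n := by positivity
  have hLM : 2 ^ n < 2 ^ d := Nat.pow_lt_pow_right (by norm_num) (by omega)
  have hdvd : 2 ^ n ∣ 2 ^ d := pow_dvd_pow 2 (by omega)
  -- The multiple of `2 ^ n` in the window.
  obtain ⟨s, hs, hPs, hsP⟩ : ∃ s, 2 ^ n ∣ s ∧ P < s ∧ s ≤ P + 2 ^ n := by
    refine ⟨2 ^ n * (P / 2 ^ n + 1), dvd_mul_right _ _, ?_, ?_⟩
    · exact Nat.lt_mul_div_succ P hL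
    · have := Nat.mul_div_le P (2 ^ n)
      rw [Nat.mul_succ]; omega
  by_cases hsM : 2 ^ d ∣ s
  · obtain ⟨q', rfl⟩ := hsM
    have hq0 : q' ≠ 0 := by rintro rfl; simp at hPs
    obtain ⟨q, rfl⟩ : ∃ q, q' = q + 1 := ⟨q' - 1, by omega⟩
    have hq : q + 1 < 2 ^ (d * k) := by
      have := div_lt_of_lt_pow (d := d) (hsP.trans_lt hP)
      rwa [Nat.mul_div_cancel_left _ hM] at this
    have H := (V.step_node k 1 q hq).fits
    have hms : 2 ^ d * (q + 1) = 2 ^ d * q + 2 ^ d := Nat.mul_succ _ _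
    have hms' : 2 ^ d * (q + 1 + 1) = 2 ^ d * (q + 1) + 2 ^ d := Nat.mul_succ _ _
    refine card_image_window hn _ P _ hs hPs hsP (S.node k 1 q).2.perm
      (S.node k 1 (q + 1)).2.perm ?_ ?_ ?_ ?_ H.forth H.back
    · intro e h1 h2 y hy
      have hdiv : e / 2 ^ d = q := by
        rw [Nat.div_eq_iff hM, Nat.mul_comm]; omega
      have hdm := Nat.div_add_mod e (2 ^ d)
      rw [hdiv] at hdm
      rw [V.edgeAxis_inner k e (by omega) y hy, hdiv]
    · intro e h1 h2 y hy
      have hdiv : e / 2 ^ d = q + 1 := by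
        rw [Nat.div_eq_iff hM, Nat.mul_comm]; omega
      have hdm := Nat.div_add_mod e (2 ^ d)
      rw [hdiv] at hdm
      rw [V.edgeAxis_inner k e (by omega) y hy, hdiv]
    -- The edge between the two cubes uses slot `inn` or `out`, hence a slot of at least `d - 2 ≥
    -- n`.
    · intro y hy h
      rw [V.edgeAxis_outer, outAxis] at h
      have h1 := Equiv.injective _ h
      have h2 := V.le_inn
      have h3 := V.le_out
      split at h1 <;> rw [← h1] at hy <;> omega
    · intro y hy h
      rw [V.edgeAxis_outer, H.axis, inAxis] at h
      have h1 := Equiv.injective _ h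
      have h2 := V.le_inn
      have h3 := V.le_out
      split at h1 <;> rw [← h1] at hy <;> omega
  -- Since `2 ^ n` divides `2 ^ d`, the nearest multiples of `2 ^ d` are at least `2 ^ n` away from
  -- `s`; the window stays inside one cube and both permutations coincide.
  · have hsm : s % 2 ^ d ≠ 0 := fun h => hsM (Nat.dvd_of_mod_eq_zero h)
    have hdm := Nat.div_add_mod s (2 ^ d)
    have hlt := Nat.mod_lt s hM
    have hm1 : 2 ^ n ∣ s % 2 ^ d := (Nat.dvd_mod_iff hdvd).2 hs
    have hge := Nat.le_of_dvd (by omega) hm1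
    have hge' := Nat.le_of_dvd (by omega) (Nat.dvd_sub hdvd hm1)
    have inner : ∀ e, P < e → e ≤ P + 2 ^ n → ∀ y : Fin d, (y : ℕ) = ruler e →
        S.edgeAxis (k + 1) e = (S.node k 1 (s / 2 ^ d)).2.perm y := by
      intro e h1 h2 y hy
      have hdiv : e / 2 ^ d = s / 2 ^ d := by
        rw [Nat.div_eq_iff hM, Nat.mul_comm]; omega
      have hdm' := Nat.div_add_mod e (2 ^ d)
      rw [hdiv] at hdm'
      rw [V.edgeAxis_inner k e (by omega) y hy, hdiv]
    have hrs : ruler s < d := by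
      rw [← ruler_mod hsm]; exact ruler_lt hsm hlt
    have hns : ∀ y : Fin d, (y : ℕ) < n →
        S.edgeAxis (k + 1) s ≠ (S.node k 1 (s / 2 ^ d)).2.perm y := by
      intro y hy h
      rw [inner s hPs hsP ⟨ruler s, hrs⟩ rfl] at h
      have h1 := Equiv.injective _ h
      have h2 := (two_pow_dvd_iff_le_ruler (by omega)).1 hs
      rw [← h1] at hy
      simp only at hy
      omega
    exact card_image_window hn _ P s hs hPs hsP _ _ (fun e h1 h2 => inner e h1 (by omega))
      (fun e h1 h2 => inner e (by omega) h2) hns hns (by simp) (by simp)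

theorem Valid.hyperorthogonal (V : S.Valid) (k : ℕ) : Hyperorthogonal (S.approx k) := by
  rintro es ⟨v, hv⟩ n hn s ⟨l, r, rfl⟩ hlen
  have hL : 0 < 2 ^ n := by positivity
  have hlength := congrArg List.length hv
  rw [length_gridPath] at hlength
  simp only [approx, List.length_map, List.length_range, List.length_append] at hlength
  cases k with
  -- A single vertex has no edges, whereas a window has `2 ^ n ≥ 1`.
  | zero => rw [mul_zero, pow_zero] at hlength; omega
  | succ k =>
    have hax : ∀ i (hi : i < (l ++ s ++ r).length),
        ((l ++ s ++ r)[i]).axis = S.edgeAxis (k + 1) (i + 1) := by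
      intro i hi
      have hi' : i + 1 < 2 ^ (d * (k + 1)) := by
        simp only [List.length_append] at hi; omega
      have h1 := getElem_gridPath_succ v (l ++ s ++ r) i hi
      simp only [← hv, approx, List.getElem_map, List.getElem_range] at h1
      have h2 := (V.step_node (k + 1) 1 i hi').vertex
      rw [h1] at h2
      refine axis_eq_of_vec_eq _ _ _ ?_ (add_left_cancel h2)
      split <;> norm_num
    have himg : (s.map Direction.axis).toFinset =
        (Finset.Ioc l.length (l.length + 2 ^ n)).image (S.edgeAxis (k + 1)) := by
      ext a
      simp only [List.mem_toFinset, List.mem_map, Finset.mem_image, Finset.mem_Ioc]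
      constructor
      · rintro ⟨e, he, rfl⟩
        obtain ⟨i, hi, rfl⟩ := List.mem_iff_getElem.1 he
        refine ⟨l.length + i + 1, by omega, ?_⟩
        have := hax (l.length + i) (by simp only [List.length_append]; omega)
        rw [← this]
        congr 1
        rw [List.getElem_append_left (by simp only [List.length_append]; omega),
          List.getElem_append_right (by omega)]
        simp
      · rintro ⟨e, he, rfl⟩
        refine ⟨s[e - 1 - l.length], List.getElem_mem _, ?_⟩
        have := hax (e - 1) (by simp only [List.length_append]; omega)
        rw [show e - 1 + 1 = e by omega] at this
        rw [← this]
        congr 1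
        rw [List.getElem_append_left (by simp only [List.length_append]; omega),
          List.getElem_append_right (by omega)]
    rw [himg]
    exact V.card_image_edgeAxis k n l.length hn (by omega)

end Scheme

end CubeCurve

namespace CubeCurve

/-! ### The generators -/

/-- Slot `x` receives the one element of `T (d - x)` that is not in `T (d - 1 - x)`. -/
theorem exists_perm_of_chain {d : ℕ} (T : ℕ → Finset (Fin d)) (hcard : ∀ m ≤ d, (T m).card = m)
    (hmono : ∀ m < d, T m ⊆ T (m + 1)) :
    ∃ σ : Equiv.Perm (Fin d), ∀ m ≤ d, ∀ x, σ x ∈ T m ↔ d ≤ (x : ℕ) + m := by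
  have hle : ∀ m' ≤ d, ∀ m ≤ m', T m ⊆ T m' := by
    intro m'
    induction m' with
    | zero => intro _ m hm; rw [Nat.le_zero.1 hm]
    | succ m' ih =>
      intro h m hm
      rcases Nat.lt_or_ge m (m' + 1) with h' | h'
      · exact (ih (by omega) m (by omega)).trans (hmono m' (by omega))
      · rw [le_antisymm hm h']
  have hex : ∀ x : Fin d, ∃ a, a ∈ T (d - x) ∧ a ∉ T (d - 1 - x) := by
    intro x
    have hx := x.2
    apply Finset.exists_mem_notMem_of_card_lt_card
    rw [hcard _ (by omega), hcard _ (by omega)]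
    omega
  choose f hf1 hf2 using hex
  have hmem : ∀ m ≤ d, ∀ x, f x ∈ T m ↔ d ≤ (x : ℕ) + m := by
    intro m hm x
    constructor
    · intro h
      by_contra! hlt
      exact hf2 x (hle _ (by omega) m (by omega) h)
    · intro h
      exact hle m hm _ (by omega) (hf1 x)
  have hinj : Function.Injective f := by
    intro x x' h
    have h1 := (hmem (d - x) (by omega) x').1 (h ▸ hf1 x)
    have h2 := (hmem (d - x') (by omega) x).1 (h ▸ hf1 x')
    have := x.2; have := x'.2
    apply Fin.ext
    omega
  exact ⟨Equiv.ofBijective f (Finite.injective_iff_bijective.1 hinj), hmem⟩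

/-- The axis along which the first child is entered. -/
def innAxis (d : ℕ) (b : Bool) : ℕ := if b then d - 1 else d - 2

/-- The axis along which the last child is left. -/
def outAxis (d : ℕ) (b : Bool) : ℕ := if b then d - 2 else d - 1

/-- The axis of the `e`-th edge of the Gray code, extended at both ends. -/
def extRuler (d : ℕ) (b : Bool) (e : ℕ) : ℕ :=
  if e = 0 then innAxis d b else if e = 2 ^ d then outAxis d b else ruler e

/-- The multiple of `2 ^ (m + 1)` that is nearest to `i + 1 / 2`. -/
def nearest (m i : ℕ) : ℕ := 2 ^ (m + 1) * ((i + 2 ^ m) / 2 ^ (m + 1))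

theorem nearest_le (m i : ℕ) : nearest m i ≤ i + 2 ^ m := Nat.mul_div_le _ _

theorem lt_nearest_add (m i : ℕ) : i < nearest m i + 2 ^ m := by
  have h := Nat.lt_mul_div_succ (i + 2 ^ m) (show 0 < 2 ^ (m + 1) by positivity)
  rw [Nat.mul_add_one] at h
  have := pow_succ 2 m
  unfold nearest
  omega

theorem nearest_eq {m i e : ℕ} (h : 2 ^ (m + 1) ∣ e) (h1 : e ≤ i + 2 ^ m) (h2 : i < e + 2 ^ m) :
    nearest m i = e := by
  obtain ⟨t, rfl⟩ := h
  unfold nearest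
  congr 1
  have := pow_succ 2 m
  rw [Nat.div_eq_iff (by positivity), Nat.mul_comm t]
  omega

theorem dvd_nearest (m i : ℕ) : 2 ^ (m + 1) ∣ nearest m i := dvd_mul_right _ _

theorem nearest_le_pow {d m i : ℕ} (hm : m + 1 ≤ d) (hi : i < 2 ^ d) : nearest m i ≤ 2 ^ d := by
  by_contra! h
  have h1 := Nat.dvd_sub (dvd_nearest m i) (pow_dvd_pow 2 hm)
  have h2 := Nat.le_of_dvd (by omega) h1
  have := nearest_le m i
  have := pow_succ 2 m
  have : 0 < 2 ^ m := by positivity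
  omega

section

variable {d : ℕ} {b : Bool}

theorem extRuler_lt (hd : 3 ≤ d) {e : ℕ} (he : e ≤ 2 ^ d) : extRuler d b e < d := by
  unfold extRuler innAxis outAxis
  split_ifs with h1 h2 <;> try omega
  all_goals exact ruler_lt h1 (by omega)

theorem extRuler_inner {e : ℕ} (h0 : e ≠ 0) (he : e < 2 ^ d) : extRuler d b e = ruler e := by
  simp [extRuler, h0, he.ne]

theorem extRuler_zero : extRuler d b 0 = innAxis d b := by simp [extRuler]

theorem extRuler_pow : extRuler d b (2 ^ d) = outAxis d b := by simp [extRuler]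

theorem extRuler_odd (hd : 3 ≤ d) (a : ℕ) : extRuler d b (2 * a + 1) = 0 := by
  have : 2 * a + 1 ≠ 2 ^ d := by
    obtain ⟨k, rfl⟩ := Nat.exists_eq_add_of_le' hd
    rw [pow_succ]; omega
  simp [extRuler, this, ruler_odd]

/-- At the two ends the value may be as small as `d - 2`, hence the bound on `m`. -/
theorem le_extRuler {m e : ℕ} (hm : m + 2 ≤ d) (h : 2 ^ m ∣ e) : m ≤ extRuler d b e := by
  unfold extRuler innAxis outAxis
  split_ifs with h1 h2 <;> try omega
  all_goals exact (two_pow_dvd_iff_le_ruler h1).1 h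

/-- The axes that the extended Gray code visits within distance `2 ^ m` of the `i`-th vertex. -/
def nearAxes (d : ℕ) (b : Bool) (m i : ℕ) : Finset (Fin d) :=
  Finset.univ.filter fun a => (a : ℕ) < m + 1 ∨ (a : ℕ) = extRuler d b (nearest m i)

theorem mem_nearAxes {m i : ℕ} {a : Fin d} :
    a ∈ nearAxes d b m i ↔ (a : ℕ) < m + 1 ∨ (a : ℕ) = extRuler d b (nearest m i) := by
  simp [nearAxes]

/-- The nearest multiple of `2 ^ (m + 1)` has an axis of at least `m + 1`, so it is not among the
axes `0, …, m`. -/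
theorem card_nearAxes {m i : ℕ} (hm : m + 3 ≤ d) (hi : i < 2 ^ d) :
    (nearAxes d b m i).card = m + 2 := by
  have hlt : extRuler d b (nearest m i) < d :=
    extRuler_lt (by omega) (nearest_le_pow (by omega) hi)
  have hle : m + 1 ≤ extRuler d b (nearest m i) := le_extRuler (by omega) (dvd_nearest m i)
  have : nearAxes d b m i =
      insert (⟨extRuler d b (nearest m i), hlt⟩ : Fin d)
        (Finset.univ.filter fun a : Fin d => (a : ℕ) < m + 1) := by
    ext a
    simp [mem_nearAxes, Fin.ext_iff, or_comm]
  rw [this, Finset.card_insert_of_notMem, Fin.card_filter_val_lt, min_eq_right (by omega)]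
  simp only [Finset.mem_filter, Finset.mem_univ, true_and]
  omega

/-- If the nearest multiple of `2 ^ (m + 1)` is also a multiple of `2 ^ (m + 2)`, it is within `2 ^
(m + 1)` of the neighbour too and is again the nearest one. Otherwise its axis is at most `m + 1`
and belongs to the next set anyway. -/
theorem nearAxes_subset {m i i' : ℕ} (hm : m + 3 ≤ d) (h1 : i ≤ i' + 1) (h2 : i' ≤ i + 1) :
    nearAxes d b m i ⊆ nearAxes d b (m + 1) i' := by
  intro a ha
  rw [mem_nearAxes] at ha ⊢
  rcases ha with ha | ha
  · left; omega
  by_cases hdvd : 2 ^ (m + 2) ∣ nearest m i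
  · right
    rw [ha]
    congr 1
    have h3 := nearest_le m i
    have h4 := lt_nearest_add m i
    have h5 := pow_succ 2 m
    have : 0 < 2 ^ m := by positivity
    exact (nearest_eq hdvd (by omega) (by omega)).symm
  · left
    have h0 : nearest m i ≠ 0 := by intro h; rw [h] at hdvd; simp at hdvd
    have hp : nearest m i ≠ 2 ^ d := by
      intro h; rw [h] at hdvd; exact hdvd (pow_dvd_pow 2 (by omega))
    rw [extRuler, if_neg h0, if_neg hp] at ha
    rw [two_pow_dvd_iff_le_ruler h0] at hdvd
    omega

/-- Of the edges `i` and `i + 1` one is odd and has axis `0`; the other is the nearest even one. -/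
theorem mem_nearAxes_zero (hd : 3 ≤ d) {i : ℕ} {a : Fin d} :
    a ∈ nearAxes d b 0 i ↔ (a : ℕ) = extRuler d b i ∨ (a : ℕ) = extRuler d b (i + 1) := by
  rw [mem_nearAxes]
  obtain ⟨c, rfl | rfl⟩ := Nat.even_or_odd' i
  · have h : nearest 0 (2 * c) = 2 * c := nearest_eq (by simp) (by omega) (by simp)
    rw [h, extRuler_odd hd]
    omega
  · have h : nearest 0 (2 * c + 1) = 2 * c + 1 + 1 :=
      nearest_eq (by simp) (by simp) (by simp)
    rw [h, extRuler_odd hd]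
    omega

/-- The children that are traversed backwards. -/
def isBack (d i : ℕ) : Bool := decide (i ≠ 0) && (decide (i + 1 = 2 ^ d) || decide (i % 2 = 0))

/-- The axis along which the end points of the `i`-th child differ. -/
def spanAxis (d : ℕ) (b : Bool) (i : ℕ) : ℕ :=
  if b ^^ isBack d i then extRuler d b i else extRuler d b (i + 1)

/-- The axes of the last `m` slots of the `i`-th child. -/
def lastAxes (d : ℕ) (b : Bool) (i : ℕ) : ℕ → Finset (Fin d)
  | 0 => ∅
  | 1 => Finset.univ.filter fun a => (a : ℕ) = spanAxis d b i
  | m + 2 => if m + 2 < d then nearAxes d b m i else Finset.univ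

theorem spanAxis_lt (hd : 3 ≤ d) {i : ℕ} (hi : i < 2 ^ d) : spanAxis d b i < d := by
  unfold spanAxis
  split
  · exact extRuler_lt hd hi.le
  · exact extRuler_lt hd hi

/-- The chain starts with the span axis, which must occupy the last slot because the ends of the
Gray code differ along the last axis, and continues with the entry and exit axes. -/
theorem exists_childPerm (hd : 3 ≤ d) (b : Bool) {i : ℕ} (hi : i < 2 ^ d) :
    ∃ σ : Equiv.Perm (Fin d), ∀ m ≤ d, ∀ x, σ x ∈ lastAxes d b i m ↔ d ≤ (x : ℕ) + m := by
  refine exists_perm_of_chain _ (fun m hm => ?_) fun m hm => ?_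
  · match m with
    | 0 => rfl
    | 1 =>
      have : lastAxes d b i 1 = {⟨spanAxis d b i, spanAxis_lt hd hi⟩} := by
        ext a; simp [lastAxes, Fin.ext_iff]
      rw [this, Finset.card_singleton]
    | m + 2 =>
      rw [lastAxes]
      split
      · exact card_nearAxes (by omega) hi
      · simp; omega
  · match m with
    | 0 => simp [lastAxes]
    | 1 =>
      intro a ha
      simp only [lastAxes, Finset.mem_filter, Finset.mem_univ, true_and] at ha ⊢
      rw [if_pos (by omega), mem_nearAxes_zero hd]
      unfold spanAxis at ha
      split at ha
      · exact .inl ha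
      · exact .inr ha
    | m + 2 =>
      simp only [lastAxes]
      rw [if_pos hm]
      split
      · exact nearAxes_subset (by omega) (by omega) (by omega)
      · exact Finset.subset_univ _

open Classical in
/-- The permutation of the axes for the `i`-th child. -/
noncomputable def childPerm (d : ℕ) (b : Bool) (i : ℕ) : Equiv.Perm (Fin d) :=
  if h : 3 ≤ d ∧ i < 2 ^ d then (exists_childPerm h.1 b h.2).choose else 1

theorem childPerm_mem (hd : 3 ≤ d) {i : ℕ} (hi : i < 2 ^ d) {m : ℕ} (hm : m ≤ d) (x : Fin d) :
    childPerm d b i x ∈ lastAxes d b i m ↔ d ≤ (x : ℕ) + m := by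
  rw [childPerm, dif_pos ⟨hd, hi⟩]
  exact (exists_childPerm hd b hi).choose_spec m hm x

theorem childPerm_mem_nearAxes (hd : 3 ≤ d) {i : ℕ} (hi : i < 2 ^ d) {m : ℕ} (hm : m + 3 ≤ d)
    (x : Fin d) : childPerm d b i x ∈ nearAxes d b m i ↔ d ≤ (x : ℕ) + m + 2 := by
  have := childPerm_mem (b := b) hd hi (show m + 2 ≤ d by omega) x
  rwa [lastAxes, if_pos (by omega)] at this

theorem childPerm_last (hd : 3 ≤ d) {i : ℕ} (hi : i < 2 ^ d) (x : Fin d) :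
    (childPerm d b i x : ℕ) = spanAxis d b i ↔ (x : ℕ) + 1 = d := by
  have := childPerm_mem (b := b) hd hi (show 1 ≤ d by omega) x
  simp only [lastAxes, Finset.mem_filter, Finset.mem_univ, true_and] at this
  have := x.2
  omega

theorem childPerm_penultimate (hd : 3 ≤ d) {i : ℕ} (hi : i < 2 ^ d) (x : Fin d)
    (hx : (x : ℕ) + 2 = d) :
    (childPerm d b i x : ℕ) =
      if b ^^ isBack d i then extRuler d b (i + 1) else extRuler d b i := by
  have h1 := (childPerm_mem_nearAxes (b := b) hd hi (m := 0) (by omega) x).2 (by omega)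
  rw [mem_nearAxes_zero hd] at h1
  have h2 : ¬ (childPerm d b i x : ℕ) = spanAxis d b i := by
    rw [childPerm_last hd hi]; omega
  unfold spanAxis at h2
  split at h2 <;> simp_all

/-- How the corners between children differ from the vertices of the Gray code. -/
def twistCorner (d : ℕ) (b : Bool) (e x : ℕ) : Bool :=
  if e = 0 then b && decide (x ≠ innAxis d b)
  else if e = 2 ^ d then b && decide (x ≠ outAxis d b)
  else if e % 2 = 1 then b || decide (x = 0)
  else if b then decide (x ≠ 0) else decide (x = 0) || decide (x = extRuler d b e)

/-- The label of the `i`-th child. -/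
noncomputable def childLabel (d : ℕ) (b : Bool) (i : ℕ) : Label d where
  perm := childPerm d b i
  flip x := gray d i x ^^ twistCorner d b (if isBack d i then i + 1 else i) x
  rev := isBack d i

/-- Along the sequence of children the end corners, relative to the Gray code, change only by
crossing each child along its span axis. `twistCorner` is the explicit solution of this recurrence;
its value at `2 ^ d` shows that the last exit is as required. -/
theorem twistCorner_succ (hd : 3 ≤ d) {i : ℕ} (hi : i < 2 ^ d) (x : ℕ) :
    twistCorner d b (i + 1) x = (twistCorner d b i x ^^ decide (x = spanAxis d b i)) := by
  obtain ⟨k, rfl⟩ := Nat.exists_eq_add_of_le' hd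
  have hpow : 2 ^ (k + 3) = 2 * (4 * 2 ^ k) := by rw [pow_add]; ring
  have hk : 0 < 2 ^ k := by positivity
  obtain ⟨c, rfl | rfl⟩ := Nat.even_or_odd' i
  · have h3 : extRuler (k + 3) b (2 * c + 1) = 0 := extRuler_odd hd c
    have n1 : 2 * c + 1 ≠ 2 ^ (k + 3) := by omega
    have m1 : (2 * c + 1) % 2 = 1 := by omega
    rcases Nat.eq_zero_or_pos c with rfl | hc
    · have hb : isBack (k + 3) (2 * 0) = false := by simp [isBack]
      have e1 : twistCorner (k + 3) b (2 * 0 + 1) x = (b || decide (x = 0)) := by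
        simp only [twistCorner, n1, m1]; simp
      rw [e1, spanAxis, hb, h3, mul_zero, extRuler_zero]
      cases b
      · simp [twistCorner]
      · by_cases hx : x = innAxis (k + 3) true <;> simp [twistCorner, hx]
    · have hne : 2 * c ≠ 2 ^ (k + 3) := by omega
      have hr : extRuler (k + 3) b (2 * c) ≠ 0 := by
        have := le_extRuler (d := k + 3) (b := b) (m := 1) (e := 2 * c) (by omega) (by simp)
        omega
      have hb : isBack (k + 3) (2 * c) = true := by simp [isBack, hc.ne']
      have e1 : twistCorner (k + 3) b (2 * c + 1) x = (b || decide (x = 0)) := by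
        simp [twistCorner, n1, m1]
      have e2 : twistCorner (k + 3) b (2 * c) x = if b then decide (x ≠ 0) else
          decide (x = 0) || decide (x = extRuler (k + 3) b (2 * c)) := by
        simp [twistCorner, hc.ne', hne]
      rw [e1, e2, spanAxis, hb, h3]
      cases b
      · rcases eq_or_ne x 0 with rfl | hx
        · simp [hr.symm]
        · simp [hx]
      · rcases eq_or_ne x 0 with rfl | hx <;> simp [*]
  · have h3 : extRuler (k + 3) b (2 * c + 1) = 0 := extRuler_odd hd c
    have n1 : 2 * c + 1 ≠ 2 ^ (k + 3) := by omega
    have e1 : twistCorner (k + 3) b (2 * c + 1) x = (b || decide (x = 0)) := by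
      simp [twistCorner, n1]
    by_cases hl : 2 * c + 1 + 1 = 2 ^ (k + 3)
    · have hb : isBack (k + 3) (2 * c + 1) = true := by simp [isBack, hl]
      rw [e1, spanAxis, hb, h3, hl, extRuler_pow]
      cases b
      · simp [twistCorner]
      · by_cases hx : x = outAxis (k + 3) true <;> simp [twistCorner, hx]
    · have hb : isBack (k + 3) (2 * c + 1) = false := by simp [isBack, hl]
      have hr : extRuler (k + 3) b (2 * c + 1 + 1) ≠ 0 := by
        have := le_extRuler (d := k + 3) (b := b) (m := 1) (e := 2 * c + 1 + 1) (by omega)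
          (by omega)
        omega
      have e2 : twistCorner (k + 3) b (2 * c + 1 + 1) x = if b then decide (x ≠ 0) else
          decide (x = 0) || decide (x = extRuler (k + 3) b (2 * c + 1 + 1)) := by
        simp [twistCorner, hl, show (2 * c + 1 + 1) % 2 = 0 by omega]
      rw [e1, e2, spanAxis, hb, h3]
      cases b
      · rcases eq_or_ne x 0 with rfl | hx
        · simp [hr.symm]
        · simp [hx]
      · rcases eq_or_ne x 0 with rfl | hx <;> simp [*]

theorem childPerm_symm (hd : 3 ≤ d) {i : ℕ} (hi : i < 2 ^ d) (x : Fin d) :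
    ((childPerm d b i).symm x : ℕ) + 1 = d ↔ (x : ℕ) = spanAxis d b i := by
  rw [← childPerm_last (b := b) hd hi, Equiv.apply_symm_apply]

theorem entry_childLabel (hd : 3 ≤ d) {i : ℕ} (hi : i < 2 ^ d) (x : Fin d) :
    (childLabel d b i).entry x = (gray d i x ^^ twistCorner d b i x) := by
  simp only [Label.entry, childLabel, childPerm_symm hd hi]
  cases isBack d i
  · simp
  · simp [twistCorner_succ hd hi]

theorem exit_childLabel (hd : 3 ≤ d) {i : ℕ} (hi : i < 2 ^ d) (x : Fin d) :
    (childLabel d b i).exit x = (gray d i x ^^ twistCorner d b (i + 1) x) := by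
  simp only [Label.exit, childLabel, childPerm_symm hd hi]
  cases isBack d i
  · simp [twistCorner_succ hd hi]
  · simp

/-- The scheme of the curves of the main theorem. -/
noncomputable def mainScheme (d : ℕ) (hd : 3 ≤ d) (b : Bool) : Scheme d where
  gen := childLabel d b
  inn := ⟨innAxis d b, by unfold innAxis; split <;> omega⟩
  out := ⟨outAxis d b, by unfold outAxis; split <;> omega⟩
  twist := b

theorem inAxis_childLabel (hd : 3 ≤ d) {i : ℕ} (hi : i < 2 ^ d) :
    ((mainScheme d hd b).inAxis (childLabel d b i) : ℕ) = extRuler d b i := by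
  have h1 := fun x : Fin d => (childPerm_last (b := b) hd hi x).2
  have h2 := fun x : Fin d => childPerm_penultimate (b := b) hd hi x
  simp only [Scheme.inAxis, mainScheme, childLabel]
  unfold spanAxis at h1
  rcases Bool.eq_false_or_eq_true (isBack d i) with hb | hb <;> cases b <;> simp [hb] at h1 h2 ⊢ <;>
    first
    | (rw [h1]; simp [innAxis, outAxis]; omega)
    | (rw [h2]; simp [innAxis, outAxis]; omega)

theorem outAxis_childLabel (hd : 3 ≤ d) {i : ℕ} (hi : i < 2 ^ d) :
    ((mainScheme d hd b).outAxis (childLabel d b i) : ℕ) = extRuler d b (i + 1) := by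
  have h1 := fun x : Fin d => (childPerm_last (b := b) hd hi x).2
  have h2 := fun x : Fin d => childPerm_penultimate (b := b) hd hi x
  simp only [Scheme.outAxis, mainScheme, childLabel]
  unfold spanAxis at h1
  rcases Bool.eq_false_or_eq_true (isBack d i) with hb | hb <;> cases b <;> simp [hb] at h1 h2 ⊢ <;>
    first
    | (rw [h1]; simp [innAxis, outAxis]; omega)
    | (rw [h2]; simp [innAxis, outAxis]; omega)

/-- A slot of `x + 2` or more for child `i'` means a set `nearAxes` of radius exponent `d - 4 - x`;
the inclusion for neighbours raises this to `d - 3 - x`, which for child `i` excludes slot `x`. -/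
theorem childPerm_near (hd : 3 ≤ d) {i i' : ℕ} (hi : i < 2 ^ d) (hi' : i' < 2 ^ d)
    (h1 : i ≤ i' + 1) (h2 : i' ≤ i + 1) (x : Fin d) (hx : (x : ℕ) + 4 ≤ d) :
    ((childPerm d b i').symm (childPerm d b i x) : ℕ) ≤ x + 1 := by
  by_contra! h
  set u := (childPerm d b i').symm (childPerm d b i x) with hu
  have hm1 := (childPerm_mem_nearAxes (b := b) hd hi' (m := d - 4 - x) (by omega) u).2 (by omega)
  rw [hu, Equiv.apply_symm_apply] at hm1
  have hm2 := nearAxes_subset (by omega) h2 h1 hm1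
  rw [childPerm_mem_nearAxes hd hi (by omega)] at hm2
  omega

/-- At the first and last child the nearest multiple is always the end of the code, so the sets are
`{0, …, m}` together with the end axis `a`. What remains for slot `0` is the other one of the two
top axes. -/
theorem childPerm_end_zero (hd : 3 ≤ d) {i : ℕ} (hi : i < 2 ^ d) {a a' : ℕ}
    (hn : ∀ m, m + 3 ≤ d → extRuler d b (nearest m i) = a) (haa : a + a' + 3 = 2 * d)
    (ha : d ≤ a + 2) (ha' : d ≤ a' + 2) (x : Fin d) (hx : (x : ℕ) = 0) :
    (childPerm d b i x : ℕ) = a' := by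
  have h := (childPerm_mem_nearAxes (b := b) hd hi (m := d - 3) (by omega) x).not.2 (by omega)
  rw [mem_nearAxes, hn _ (by omega)] at h
  have := (childPerm d b i x).2
  omega

/-- From exponent `d - x - 3` to `d - x - 2` these sets gain only the axis `d - 2 - x`. -/
theorem childPerm_end (hd : 3 ≤ d) {i : ℕ} (hi : i < 2 ^ d) {a : ℕ}
    (hn : ∀ m, m + 3 ≤ d → extRuler d b (nearest m i) = a) (x : Fin d)
    (hx1 : 1 ≤ (x : ℕ)) (hx : (x : ℕ) + 3 ≤ d) :
    (childPerm d b i x : ℕ) = d - 2 - x := by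
  have h := (childPerm_mem_nearAxes (b := b) hd hi (m := d - x - 3) (by omega) x).not.2 (by omega)
  rw [mem_nearAxes, hn _ (by omega)] at h
  have h' := (childPerm_mem_nearAxes (b := b) hd hi (m := d - x - 2) (by omega) x).2 (by omega)
  rw [mem_nearAxes, hn _ (by omega)] at h'
  omega

theorem nearest_zero (m : ℕ) : nearest m 0 = 0 :=
  nearest_eq (by simp) (by simp) (by simp)

theorem nearest_last {m : ℕ} (hm : m + 1 ≤ d) : nearest m (2 ^ d - 1) = 2 ^ d := by
  have : 0 < 2 ^ m := by positivity
  have : 0 < 2 ^ d := by positivity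
  exact nearest_eq (pow_dvd_pow 2 hm) (by omega) (by omega)

theorem valid_mainScheme (d : ℕ) (hd : 3 ≤ d) (b : Bool) : (mainScheme d hd b).Valid := by
  have hM : 0 < 2 ^ d := by positivity
  have hinn : innAxis d b + outAxis d b + 3 = 2 * d := by
    cases b <;> simp [innAxis, outAxis] <;> omega
  have hle1 : d ≤ innAxis d b + 2 := by cases b <;> simp [innAxis] <;> omega
  have hle2 : d ≤ outAxis d b + 2 := by cases b <;> simp [outAxis] <;> omega
  have hfirst : ∀ m, m + 3 ≤ d → extRuler d b (nearest m 0) = innAxis d b := fun m _ => by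
    rw [nearest_zero, extRuler_zero]
  have hlast : ∀ m, m + 3 ≤ d → extRuler d b (nearest m (2 ^ d - 1)) = outAxis d b :=
    fun m hm => by rw [nearest_last (by omega), extRuler_pow]
  have hout : ∀ i, i + 1 < 2 ^ d →
      ((mainScheme d hd b).outAxis (childLabel d b i) : ℕ) = ruler (i + 1) := fun i hi => by
    rw [outAxis_childLabel hd (by omega), extRuler_inner (by omega) hi]
  refine
    { three_le := hd
      inn_ne_out := fun h => ?_
      le_inn := hle1
      le_out := hle2
      fits := fun i hi => ⟨?_, fun x => ?_, ?_, ?_⟩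
      outAxis_gen := hout
      exit_gen := fun i hi => ?_
      inAxis_first := ?_
      entry_first := fun x => ?_
      perm_first_zero := fun x hx => Fin.ext ?_
      perm_first := childPerm_end hd hM hfirst
      outAxis_last := ?_
      exit_last := fun x => ?_
      perm_last_zero := fun x hx => Fin.ext ?_
      perm_last := childPerm_end hd (by omega) hlast }
  · have := congrArg Fin.val h
    simp only [mainScheme] at this
    omega
  · apply Fin.ext
    have h1 := outAxis_childLabel (b := b) hd (show i < 2 ^ d by omega)
    have h2 := inAxis_childLabel (b := b) hd hi
    exact h1.trans h2.symm
  · have h1 := hout i hi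
    change (childLabel d b (i + 1)).entry x = ((childLabel d b i).exit x ^^
      decide (x = (mainScheme d hd b).outAxis (childLabel d b i)))
    rw [entry_childLabel hd hi, exit_childLabel hd (by omega), gray_succ]
    simp only [Fin.ext_iff, h1]
    cases gray d i x <;> cases twistCorner d b (i + 1) x <;> simp
  · exact childPerm_near hd (by omega) hi (by omega) (by omega)
  · exact childPerm_near hd hi (by omega) (by omega) (by omega)
  · change (childLabel d b i).exit _ = !gray d i _
    rw [exit_childLabel hd (by omega)]
    have h1 := outAxis_childLabel (b := b) hd (show i < 2 ^ d by omega)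
    -- The value `true` means that the exit bit is opposite to the Gray code bit: the child is left
    -- through the facet that faces its successor.
    have ht : twistCorner d b (i + 1) (extRuler d b (i + 1)) = true := by
      obtain ⟨c, rfl | rfl⟩ := Nat.even_or_odd' i
      · rw [extRuler_odd hd]
        simp [twistCorner, hi.ne]
      · have hr : extRuler d b (2 * c + 1 + 1) ≠ 0 := by
          have := le_extRuler (d := d) (b := b) (m := 1) (e := 2 * c + 1 + 1) (by omega)
            (by omega)
          omega
        simp [twistCorner, hi.ne, show (2 * c + 1 + 1) % 2 = 0 by omega, hr]
    change (gray d i _ ^^ twistCorner d b (i + 1)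
      ((mainScheme d hd b).outAxis (childLabel d b i) : ℕ)) = _
    rw [h1, ht]
    simp [mainScheme]
  · apply Fin.ext
    exact (inAxis_childLabel hd hM).trans extRuler_zero
  · refine (entry_childLabel hd hM x).trans ?_
    simp [gray_zero, twistCorner, mainScheme, Fin.ext_iff]
  · exact childPerm_end_zero hd hM hfirst hinn hle1 hle2 x hx
  · apply Fin.ext
    refine (outAxis_childLabel hd (by omega)).trans ?_
    rw [Nat.sub_add_cancel hM, extRuler_pow]
    rfl
  · refine (exit_childLabel hd (by omega) x).trans ?_
    rw [Nat.sub_add_cancel hM, gray_last]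
    simp [twistCorner, mainScheme, Fin.ext_iff]
  · exact childPerm_end_zero hd (by omega) hlast (by omega) hle2 hle1 x hx

end

end CubeCurve

namespace CubeCurve

/-! ### The limit of the approximating curves -/

/-- The vertices of nested approximating curves: every cube is divided into `2 ^ d` cubes that are
visited consecutively, and consecutive cubes touch each other. -/
structure NestedCubes (d : ℕ) (V : ℕ → ℕ → Vertex d) : Prop where
  zero : ∀ x, V 0 0 x = 0
  child : ∀ k n x, V (k + 1) n x = 2 * V k (n / 2 ^ d) x ∨
    V (k + 1) n x = 2 * V k (n / 2 ^ d) x + 1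
  surj : ∀ k p (c : Fin d → Bool), ∃ i < 2 ^ d,
    V (k + 1) (2 ^ d * p + i) = 2 • V k p + corner c
  adj : ∀ k n, n + 1 < 2 ^ (d * k) → ∀ x, |V k (n + 1) x - V k n x| ≤ 1

/-- The index of an interval of level `k` that contains `t`. -/
noncomputable def intervalIndex (d k : ℕ) (t : ℝ) : ℕ :=
  min ⌊t * 2 ^ (d * k)⌋₊ (2 ^ (d * k) - 1)

theorem intervalIndex_lt (d k : ℕ) (t : ℝ) : intervalIndex d k t < 2 ^ (d * k) := by
  have : 0 < 2 ^ (d * k) := by positivity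
  unfold intervalIndex
  omega

/-- The cap in `intervalIndex`, needed for `t = 1`, is compatible with division because `2 ^ (d * (k
+ 1)) - 1` has only maximal digits in base `2 ^ d`. -/
theorem intervalIndex_succ_div (d k : ℕ) (t : ℝ) :
    intervalIndex d (k + 1) t / 2 ^ d = intervalIndex d k t := by
  have hM : 0 < 2 ^ d := by positivity
  have hN : 0 < 2 ^ (d * k) := by positivity
  have h1 : ⌊t * 2 ^ (d * (k + 1))⌋₊ / 2 ^ d = ⌊t * 2 ^ (d * k)⌋₊ := by
    have h := Nat.floor_div_natCast (t * 2 ^ (d * (k + 1))) (2 ^ d)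
    rw [← h]
    congr 1
    rw [Nat.mul_succ, pow_add]
    push_cast
    field_simp
  have h2 : (2 ^ (d * (k + 1)) - 1) / 2 ^ d = 2 ^ (d * k) - 1 := by
    have h3 : 2 ^ (d * (k + 1)) = 2 ^ d * 2 ^ (d * k) := by rw [← pow_add]; congr 1; ring
    have h4 : 2 ^ d * (2 ^ (d * k) - 1) = 2 ^ d * 2 ^ (d * k) - 2 ^ d := by
      rw [Nat.mul_sub, mul_one]
    have h5 : 2 ^ d * 1 ≤ 2 ^ d * 2 ^ (d * k) := Nat.mul_le_mul_left _ hN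
    rw [Nat.div_eq_iff hM, Nat.mul_comm, h3, h4]
    omega
  have hmono : Monotone fun n => n / 2 ^ d := fun a b h => Nat.div_le_div_right h
  unfold intervalIndex
  rw [hmono.map_min, h1, h2]

theorem intervalIndex_eq {d k n : ℕ} {t : ℝ} (hn : n < 2 ^ (d * k))
    (h1 : (n : ℝ) / 2 ^ (d * k) ≤ t) (h2 : t < ((n : ℝ) + 1) / 2 ^ (d * k)) :
    intervalIndex d k t = n := by
  have hN : (0 : ℝ) < 2 ^ (d * k) := by positivity
  rw [div_le_iff₀ hN] at h1
  rw [lt_div_iff₀ hN] at h2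
  have : ⌊t * 2 ^ (d * k)⌋₊ = n := by
    rw [Nat.floor_eq_iff (le_trans (by positivity) h1)]
    exact ⟨h1, h2⟩
  unfold intervalIndex
  rw [this]
  omega

theorem intervalIndex_near {d k : ℕ} {s t : ℝ} (ht : 0 ≤ t)
    (h : |s - t| ≤ 1 / 2 ^ (d * k)) : intervalIndex d k s ≤ intervalIndex d k t + 1 := by
  have hN : (0 : ℝ) < 2 ^ (d * k) := by positivity
  have h1 : s * 2 ^ (d * k) ≤ t * 2 ^ (d * k) + 1 := by
    have := (abs_le.1 h).2
    rw [le_div_iff₀ hN] at this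
    linarith
  have h2 := Nat.floor_le_floor h1
  rw [Nat.floor_add_one (by positivity)] at h2
  unfold intervalIndex
  omega

namespace NestedCubes

variable {d : ℕ} {V : ℕ → ℕ → Vertex d}

/-- The limit of nested approximating curves. -/
noncomputable def limit (V : ℕ → ℕ → Vertex d) (t : ℝ) (x : Fin d) : ℝ :=
  ⨆ k, (V k (intervalIndex d k t) x : ℝ) / 2 ^ k

theorem child_interval (H : NestedCubes d V) (k n : ℕ) (x : Fin d) :
    (V k (n / 2 ^ d) x : ℝ) / 2 ^ k ≤ (V (k + 1) n x : ℝ) / 2 ^ (k + 1) ∧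
      ((V (k + 1) n x : ℝ) + 1) / 2 ^ (k + 1) ≤ ((V k (n / 2 ^ d) x : ℝ) + 1) / 2 ^ k := by
  have hp : (0 : ℝ) < 2 ^ k := by positivity
  rw [pow_succ, div_le_div_iff₀ hp (by positivity), div_le_div_iff₀ (by positivity) hp]
  rcases H.child k n x with h | h <;> rw [h] <;> push_cast <;> constructor <;> nlinarith

theorem limit_mem (H : NestedCubes d V) (t : ℝ) (x : Fin d) (k : ℕ) :
    (V k (intervalIndex d k t) x : ℝ) / 2 ^ k ≤ limit V t x ∧
      limit V t x ≤ ((V k (intervalIndex d k t) x : ℝ) + 1) / 2 ^ k := by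
  have hstep := fun k => H.child_interval k (intervalIndex d (k + 1) t) x
  simp only [intervalIndex_succ_div] at hstep
  have hlow : Monotone fun k => (V k (intervalIndex d k t) x : ℝ) / 2 ^ k :=
    monotone_nat_of_le_succ fun k => (hstep k).1
  have hup : Antitone fun k => ((V k (intervalIndex d k t) x : ℝ) + 1) / 2 ^ k :=
    antitone_nat_of_succ_le fun k => (hstep k).2
  have hle : ∀ k, (V k (intervalIndex d k t) x : ℝ) / 2 ^ k ≤
      ((V k (intervalIndex d k t) x : ℝ) + 1) / 2 ^ k := fun k => by gcongr; linarith
  have := Set.mem_iInter.1 (hlow.ciSup_mem_iInter_Icc_of_antitone hup hle) k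
  exact this

/-- Times this close have equal or consecutive indices, and consecutive cubes touch. -/
theorem abs_sub_limit_le (H : NestedCubes d V) {s t : ℝ} (hs : 0 ≤ s) (ht : 0 ≤ t) (k : ℕ)
    (h : |s - t| ≤ 1 / 2 ^ (d * k)) (x : Fin d) :
    |limit V s x - limit V t x| ≤ 2 / 2 ^ k := by
  have hp : (0 : ℝ) < 2 ^ k := by positivity
  have h1 := intervalIndex_near ht h
  have h2 := intervalIndex_near hs (by rwa [abs_sub_comm])
  have hV : |(V k (intervalIndex d k s) x : ℝ) - V k (intervalIndex d k t) x| ≤ 1 := by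
    have hls := intervalIndex_lt d k s
    have hlt := intervalIndex_lt d k t
    rcases lt_trichotomy (intervalIndex d k s) (intervalIndex d k t) with h | h | h
    · have he : intervalIndex d k t = intervalIndex d k s + 1 := by omega
      rw [he] at hlt ⊢
      rw [abs_sub_comm]
      exact_mod_cast H.adj k _ hlt x
    · rw [h]; simp
    · have he : intervalIndex d k s = intervalIndex d k t + 1 := by omega
      rw [he] at hls ⊢
      exact_mod_cast H.adj k _ hls x
  obtain ⟨a1, a2⟩ := H.limit_mem s x k
  obtain ⟨b1, b2⟩ := H.limit_mem t x k
  rw [div_le_iff₀ hp] at a1 b1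
  rw [le_div_iff₀ hp] at a2 b2
  rw [abs_le] at hV ⊢
  rw [le_div_iff₀ hp, ← neg_div, div_le_iff₀ hp]
  constructor <;> linarith

/-- The right end of an interval usually has the index of the next interval; it is reached as a
limit of times from the left, using `abs_sub_limit_le`. -/
theorem limit_mem_of_mem (H : NestedCubes d V) {k n : ℕ} (hn : n < 2 ^ (d * k)) {t : ℝ}
    (h1 : (n : ℝ) / 2 ^ (d * k) ≤ t) (h2 : t ≤ ((n : ℝ) + 1) / 2 ^ (d * k)) (x : Fin d) :
    (V k n x : ℝ) / 2 ^ k ≤ limit V t x ∧ limit V t x ≤ ((V k n x : ℝ) + 1) / 2 ^ k := by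
  have hN : (0 : ℝ) < 2 ^ (d * k) := by positivity
  have ht : 0 ≤ t := le_trans (by positivity) h1
  have key : ∀ ε > (0 : ℝ), (V k n x : ℝ) / 2 ^ k ≤ limit V t x + ε ∧
      limit V t x ≤ ((V k n x : ℝ) + 1) / 2 ^ k + ε := by
    intro ε hε
    obtain ⟨m, hm⟩ := exists_pow_lt_of_lt_one (half_pos hε) (show (1 / 2 : ℝ) < 1 by norm_num)
    have hm' : (2 : ℝ) / 2 ^ m < ε := by
      rw [one_div, inv_pow] at hm
      rw [div_eq_mul_inv]
      linarith
    set s := max ((n : ℝ) / 2 ^ (d * k)) (t - 1 / 2 ^ (d * m)) with hs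
    have hδ : (0 : ℝ) < 1 / 2 ^ (d * m) := by positivity
    have hs1 : (n : ℝ) / 2 ^ (d * k) ≤ s := le_max_left _ _
    have hs2 : s < ((n : ℝ) + 1) / 2 ^ (d * k) :=
      max_lt (by gcongr; linarith) (by linarith)
    have hst : |s - t| ≤ 1 / 2 ^ (d * m) := by
      have h3 : s ≤ t := max_le h1 (by linarith)
      have h4 : t - 1 / 2 ^ (d * m) ≤ s := le_max_right _ _
      rw [abs_le]
      constructor <;> linarith
    have h5 := abs_le.1 (H.abs_sub_limit_le (le_trans (by positivity) hs1) ht m hst x)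
    have h6 := H.limit_mem s x k
    rw [intervalIndex_eq hn hs1 hs2] at h6
    constructor <;> linarith [h5.1, h5.2, h6.1, h6.2]
  exact ⟨le_of_forall_pos_le_add fun ε hε => (key ε hε).1,
    le_of_forall_pos_le_add fun ε hε => (key ε hε).2⟩

/-- At each subdivision the half containing `w x` is chosen separately in every coordinate; some
child realises this choice of corner. -/
theorem exists_descendant (H : NestedCubes d V) (k n j : ℕ) (w : Fin d → ℝ)
    (hw : ∀ x, (V k n x : ℝ) / 2 ^ k ≤ w x ∧ w x ≤ ((V k n x : ℝ) + 1) / 2 ^ k) :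
    ∃ m < 2 ^ (d * j), ∀ x, (V (k + j) (2 ^ (d * j) * n + m) x : ℝ) / 2 ^ (k + j) ≤ w x ∧
      w x ≤ ((V (k + j) (2 ^ (d * j) * n + m) x : ℝ) + 1) / 2 ^ (k + j) := by
  induction j with
  | zero => exact ⟨0, by simp, by simpa using hw⟩
  | succ j ih =>
    obtain ⟨m, hm, h⟩ := ih
    set p := 2 ^ (d * j) * n + m with hp
    obtain ⟨i, hi, hV⟩ := H.surj (k + j) p
      fun x => decide ((2 * (V (k + j) p x : ℝ) + 1) / 2 ^ (k + j + 1) ≤ w x)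
    refine ⟨2 ^ d * m + i, ?_, fun x => ?_⟩
    · have : 2 ^ d * (m + 1) ≤ 2 ^ d * 2 ^ (d * j) := Nat.mul_le_mul_left _ hm
      rw [Nat.mul_succ d, Nat.add_comm (d * j), pow_add]
      rw [Nat.mul_succ] at this
      omega
    · have he : 2 ^ (d * (j + 1)) * n + (2 ^ d * m + i) = 2 ^ d * p + i := by
        rw [hp, Nat.mul_succ d, pow_add]; ring
      have hp2 : (0 : ℝ) < 2 ^ (k + j) := by positivity
      obtain ⟨h1, h2⟩ := h x
      rw [he, ← add_assoc, hV]
      simp only [Pi.add_apply, Pi.smul_apply, corner]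
      rw [div_le_iff₀ hp2] at h1
      rw [le_div_iff₀ hp2] at h2
      by_cases hc : (2 * (V (k + j) p x : ℝ) + 1) / 2 ^ (k + j + 1) ≤ w x
      · simp only [hc, decide_true]
        rw [div_le_iff₀ (by positivity), pow_succ] at hc
        rw [div_le_iff₀ (by positivity), le_div_iff₀ (by positivity), pow_succ]
        push_cast [nsmul_eq_mul]
        simp only [Bool.toNat_true, Nat.cast_one]
        constructor <;> linarith
      · simp only [hc, decide_false]
        rw [not_le, lt_div_iff₀ (by positivity), pow_succ] at hc
        rw [div_le_iff₀ (by positivity), le_div_iff₀ (by positivity), pow_succ]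
        push_cast [nsmul_eq_mul]
        simp only [Bool.toNat_false, Nat.cast_zero]
        constructor <;> linarith

theorem limit_mem_unitInterval (H : NestedCubes d V) (t : ℝ) (x : Fin d) :
    limit V t x ∈ unitInterval := by
  have h := H.limit_mem t x 0
  have h0 : intervalIndex d 0 t = 0 := by
    have := intervalIndex_lt d 0 t
    simpa using this
  rw [h0, H.zero] at h
  simpa using h

/-- The limit of nested approximating curves as a map between cubes. -/
noncomputable def limitMap (H : NestedCubes d V) (t : unitInterval) (x : Fin d) : unitInterval :=
  ⟨limit V t x, H.limit_mem_unitInterval t x⟩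

theorem continuous_limitMap (H : NestedCubes d V) : Continuous H.limitMap := by
  refine continuous_pi fun x => ?_
  rw [Metric.continuous_iff]
  intro t ε hε
  obtain ⟨m, hm⟩ := exists_pow_lt_of_lt_one (half_pos hε) (show (1 / 2 : ℝ) < 1 by norm_num)
  have hm' : (2 : ℝ) / 2 ^ m < ε := by
    rw [one_div, inv_pow] at hm
    rw [div_eq_mul_inv]
    linarith
  refine ⟨1 / 2 ^ (d * m), by positivity, fun s hs => ?_⟩
  rw [Subtype.dist_eq, Real.dist_eq] at hs ⊢
  exact (H.abs_sub_limit_le s.2.1 t.2.1 m hs.le x).trans_lt hm'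

theorem image_limitMap (H : NestedCubes d V) {k n : ℕ} (hn : n < 2 ^ (d * k)) :
    H.limitMap '' {t | (n : ℝ) / 2 ^ (d * k) ≤ t ∧ (t : ℝ) ≤ ((n : ℝ) + 1) / 2 ^ (d * k)} =
      {w | ∀ x, (V k n x : ℝ) / 2 ^ k ≤ w x ∧ (w x : ℝ) ≤ ((V k n x : ℝ) + 1) / 2 ^ k} := by
  apply Set.Subset.antisymm
  · rintro _ ⟨t, ⟨h1, h2⟩, rfl⟩ x
    exact H.limit_mem_of_mem hn h1 h2 x
  · intro w hw
    set I := {t : unitInterval |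
      (n : ℝ) / 2 ^ (d * k) ≤ t ∧ (t : ℝ) ≤ ((n : ℝ) + 1) / 2 ^ (d * k)} with hI
    have hclosed : IsClosed I :=
      (isClosed_le continuous_const continuous_subtype_val).inter
        (isClosed_le continuous_subtype_val continuous_const)
    have hcompact : IsClosed (H.limitMap '' I) :=
      (hclosed.isCompact.image H.continuous_limitMap).isClosed
    -- The image of a compact interval is closed, so it suffices to approximate `w` by the values at
    -- the starting times of small descendant intervals.
    rw [← hcompact.closure_eq, Metric.mem_closure_iff]
    intro ε hε
    obtain ⟨j, hj⟩ := exists_pow_lt_of_lt_one hε (show (1 / 2 : ℝ) < 1 by norm_num)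
    obtain ⟨m, hm, h⟩ := H.exists_descendant k n j (fun x => (w x : ℝ)) hw
    have hN : (0 : ℝ) < 2 ^ (d * k) := by positivity
    have hN' : (0 : ℝ) < 2 ^ (d * (k + j)) := by positivity
    have hpow : 2 ^ (d * (k + j)) = 2 ^ (d * j) * 2 ^ (d * k) := by
      rw [← pow_add]; congr 1; ring
    have hpow' : (2 : ℝ) ^ (d * (k + j)) = 2 ^ (d * j) * 2 ^ (d * k) := by
      rw [← pow_add]; congr 1; ring
    set q := 2 ^ (d * j) * n + m with hq
    have hq1 : q + 1 ≤ 2 ^ (d * j) * (n + 1) := by rw [Nat.mul_succ]; omega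
    have hqlt : q < 2 ^ (d * (k + j)) := by
      rw [hpow]
      exact hq1.trans (Nat.mul_le_mul_left _ hn)
    have hq1' : (q : ℝ) + 1 ≤ 2 ^ (d * j) * ((n : ℝ) + 1) := by exact_mod_cast hq1
    have hq0' : (2 : ℝ) ^ (d * j) * n ≤ q := by
      have : 2 ^ (d * j) * n ≤ q := by omega
      exact_mod_cast this
    have ht1 : (n : ℝ) / 2 ^ (d * k) ≤ q / 2 ^ (d * (k + j)) := by
      rw [div_le_div_iff₀ hN hN', hpow']
      nlinarith
    have ht2 : (q : ℝ) / 2 ^ (d * (k + j)) ≤ ((n : ℝ) + 1) / 2 ^ (d * k) := by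
      rw [div_le_div_iff₀ hN' hN, hpow']
      nlinarith
    have ht3 : (q : ℝ) / 2 ^ (d * (k + j)) ≤ 1 := by
      rw [div_le_one hN']
      exact_mod_cast hqlt.le
    refine ⟨_, ⟨⟨(q : ℝ) / 2 ^ (d * (k + j)), by positivity, ht3⟩, ⟨ht1, ht2⟩, rfl⟩, ?_⟩
    have hj' : (1 : ℝ) / 2 ^ (k + j) < ε := by
      refine lt_of_le_of_lt ?_ hj
      rw [one_div, one_div, inv_pow]
      exact inv_anti₀ (by positivity) (pow_le_pow_right₀ (by norm_num) (by omega))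
    rw [dist_pi_lt_iff hε]
    intro x
    refine lt_of_le_of_lt ?_ hj'
    rw [Subtype.dist_eq, Real.dist_eq]
    have hm1 := H.limit_mem_of_mem hqlt le_rfl (by gcongr; linarith) x
    have hm2 := h x
    rw [add_div] at hm1 hm2
    simp only [limitMap]
    rw [abs_le]
    constructor <;> linarith [hm1.1, hm1.2, hm2.1, hm2.2]

theorem surjective_limitMap (H : NestedCubes d V) : Function.Surjective H.limitMap := by
  intro w
  have h := H.image_limitMap (k := 0) (n := 0) (by simp)
  have hw : w ∈ {w : Fin d → unitInterval | ∀ x, (V 0 0 x : ℝ) / 2 ^ 0 ≤ w x ∧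
      (w x : ℝ) ≤ ((V 0 0 x : ℝ) + 1) / 2 ^ 0} := by
    intro x
    rw [H.zero]
    have h1 := (w x).2.1
    have h2 := (w x).2.2
    simp only [Int.cast_zero, pow_zero, div_one, zero_add]
    exact ⟨h1, h2⟩
  rw [← h] at hw
  obtain ⟨t, -, rfl⟩ := hw
  exact ⟨t, rfl⟩

end NestedCubes

end CubeCurve

/-! ### The space-filling curve of a valid scheme and its starting point -/

namespace CubeCurve

namespace Scheme

variable {d : ℕ} {S : Scheme d}

theorem Valid.nestedCubes (V : S.Valid) : NestedCubes d fun k n => (S.node k 1 n).1 where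
  zero _ := rfl
  child k n x := by
    simp only [node, Pi.add_apply, corner, nsmul_eq_mul, Nat.cast_ofNat]
    cases (S.node k 1 (n / 2 ^ d)).2.cornerAct
      (gray d ((S.node k 1 (n / 2 ^ d)).2.childIndex (n % 2 ^ d))) x <;> simp
  surj k p c := S.exists_child k 1 p c
  adj k n hn x := by
    rw [(V.step_node k 1 n hn).vertex]
    rcases eq_or_ne x (S.outAxis (S.node k 1 n).2) with rfl | hx
    · simp only [Pi.add_apply, Pi.single_eq_same, add_sub_cancel_left]
      split <;> simp
    · simp [hx]

/-- The space-filling curve of a valid scheme. -/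
noncomputable def Valid.curve (V : S.Valid) : unitInterval → Fin d → unitInterval :=
  V.nestedCubes.limitMap

theorem Valid.approximates (V : S.Valid) : Approximates S.approx V.curve where
  zero := approx_zero
  kCurve := V.isKCurve_approx
  inflation k := ⟨_, V.isInflation k⟩
  image k i v hv := by
    obtain ⟨hi, hv⟩ := List.getElem?_eq_some_iff.1 hv
    simp only [approx, List.length_map, List.length_range] at hi
    have hv' : (S.node k 1 i).1 = v := by simpa [approx] using hv
    subst hv'
    exact V.nestedCubes.image_limitMap hi

theorem Valid.isSelfSimilarHyperorthogonalWellFolded (V : S.Valid) :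
    IsSelfSimilarHyperorthogonalWellFolded V.curve where
  spaceFilling := ⟨V.nestedCubes.continuous_limitMap, V.nestedCubes.surjective_limitMap⟩
  approximating := ⟨S.approx, V.approximates, V.wellFolded, V.hyperorthogonal, isConcatOfCopies⟩

theorem Valid.inAxis_node_zero (V : S.Valid) (k : ℕ) : S.inAxis (S.node k 1 0).2 = S.inn := by
  induction k with
  | zero => simp [node, inAxis, Label.one_rev, Label.one_perm_apply]
  | succ k ih =>
    have := V.inAxis_firstGen (S.node k 1 0).2
    rw [ih] at this
    simpa [node, firstGen] using this

/-- Every passage to the first child flips all coordinates except the entry axis if the scheme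
twists, and none otherwise; hence the parity of `k`. -/
theorem Valid.entry_node_zero (V : S.Valid) (k : ℕ) (x : Fin d) :
    (S.node k 1 0).2.entry x = (S.twist && decide (k % 2 = 1) && decide (x ≠ S.inn)) := by
  induction k with
  | zero => simp [node, Label.entry, Label.one_rev, Label.one_flip]
  | succ k ih =>
    have := V.entry_firstGen (S.node k 1 0).2 x
    rw [ih, V.inAxis_node_zero] at this
    simp only [node, Nat.zero_div, Nat.zero_mod]
    rw [firstGen] at this
    rw [this]
    rcases Nat.mod_two_eq_zero_or_one k with h | h
    · simp [h, Nat.add_mod]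
    · cases S.twist <;> simp [h, Nat.add_mod]

theorem Valid.node_succ_zero (V : S.Valid) (k : ℕ) (x : Fin d) :
    (S.node (k + 1) 1 0).1 x = 2 * (S.node k 1 0).1 x +
      if S.twist && decide (k % 2 = 1) && decide (x ≠ S.inn) then 1 else 0 := by
  simp only [node, Nat.zero_div, Nat.zero_mod, Pi.add_apply, Label.entry_first_cornerAct, corner,
    V.entry_node_zero, nsmul_eq_mul, Nat.cast_ofNat]
  cases S.twist && decide (k % 2 = 1) && decide (x ≠ S.inn) <;> simp

theorem Valid.curve_zero_eq (V : S.Valid) (x : Fin d) (a : ℝ)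
    (h : ∀ k, ((S.node k 1 0).1 x : ℝ) ≤ a * 2 ^ k ∧ a * 2 ^ k ≤ (S.node k 1 0).1 x + 1) :
    (V.curve 0 x : ℝ) = a := by
  have key : ∀ k, |(V.curve 0 x : ℝ) - a| ≤ 1 / 2 ^ k := by
    intro k
    have hp : (0 : ℝ) < 2 ^ k := by positivity
    have h0 : intervalIndex d k 0 = 0 := by simp [intervalIndex]
    have h1 := V.nestedCubes.limit_mem 0 x k
    rw [h0, div_le_iff₀ hp, le_div_iff₀ hp] at h1
    obtain ⟨h2, h3⟩ := h k
    have he : (V.curve 0 x : ℝ) = NestedCubes.limit (fun k n => (S.node k 1 n).1) 0 x := by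
      simp only [curve, NestedCubes.limitMap, Set.Icc.coe_zero]
    rw [he, abs_le, ← neg_div, le_div_iff₀ hp, div_le_iff₀ hp]
    constructor <;> linarith [h1.1, h1.2]
  have hlim : Filter.Tendsto (fun k : ℕ => (1 : ℝ) / 2 ^ k) Filter.atTop (nhds 0) := by
    simpa [one_div] using
      tendsto_pow_atTop_nhds_zero_of_lt_one (r := (1 / 2 : ℝ)) (by norm_num) (by norm_num)
  have h0 : |(V.curve 0 x : ℝ) - a| ≤ 0 := ge_of_tendsto' hlim key
  exact sub_eq_zero.1 (abs_nonpos_iff.1 h0)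

theorem Valid.curve_zero_eq_zero (V : S.Valid) (x : Fin d) (h : S.twist = false ∨ x = S.inn) :
    (V.curve 0 x : ℝ) = 0 := by
  refine V.curve_zero_eq x 0 fun k => ?_
  have : (S.node k 1 0).1 x = 0 := by
    induction k with
    | zero => rfl
    | succ k ih =>
      rw [V.node_succ_zero, ih]
      rcases h with h | h <;> simp [h]
  simp [this]

theorem Valid.curve_zero_eq_third (V : S.Valid) (x : Fin d) (h : S.twist = true)
    (hx : x ≠ S.inn) : (V.curve 0 x : ℝ) = 1 / 3 := by
  refine V.curve_zero_eq x (1 / 3) fun k => ?_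
  -- The coordinate is `2 ^ k / 3` rounded down, with remainder alternating between `1` and `2`.
  have : (2 : ℤ) ^ k - 3 * (S.node k 1 0).1 x = if k % 2 = 1 then 2 else 1 := by
    induction k with
    | zero => simp [node]
    | succ k ih =>
      rw [V.node_succ_zero, pow_succ]
      rcases Nat.mod_two_eq_zero_or_one k with h2 | h2
      · simp [h, hx, h2, Nat.add_mod] at ih ⊢
        omega
      · simp [h, hx, h2, Nat.add_mod] at ih ⊢
        omega
  have h1 : (2 : ℤ) ^ k - 3 * (S.node k 1 0).1 x ≤ 2 := by rw [this]; split <;> norm_num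
  have h2 : 1 ≤ (2 : ℤ) ^ k - 3 * (S.node k 1 0).1 x := by rw [this]; split <;> norm_num
  have h1' : (2 : ℝ) ^ k - 3 * (S.node k 1 0).1 x ≤ 2 := by exact_mod_cast h1
  have h2' : 1 ≤ (2 : ℝ) ^ k - 3 * (S.node k 1 0).1 x := by exact_mod_cast h2
  constructor <;> linarith

end Scheme

end CubeCurve

theorem mainTheorem4 (d : ℕ) (hd : 3 ≤ d) :
    (∃ f : unitInterval → Fin d → unitInterval,
      IsSelfSimilarHyperorthogonalWellFolded f ∧ ∀ j, (f 0 j : ℝ) = 0) ∧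
    (∃ f : unitInterval → Fin d → unitInterval,
      IsSelfSimilarHyperorthogonalWellFolded f ∧
        ∀ j : Fin d, (f 0 j : ℝ) = if (j : ℕ) + 1 = d then 0 else 1 / 3) := by
  have V := CubeCurve.valid_mainScheme d hd
  refine ⟨⟨(V false).curve, (V false).isSelfSimilarHyperorthogonalWellFolded, fun j =>
    (V false).curve_zero_eq_zero j (.inl rfl)⟩,
    ⟨(V true).curve, (V true).isSelfSimilarHyperorthogonalWellFolded, fun j => ?_⟩⟩
  -- In the twisted scheme the entry axis is the last one, and its coordinate is the only one that
  -- stays `0`.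
  have hinn : ((CubeCurve.mainScheme d hd true).inn : ℕ) = d - 1 := rfl
  split_ifs with hj
  · exact (V true).curve_zero_eq_zero j (.inr (Fin.ext (by rw [hinn]; omega)))
  · refine (V true).curve_zero_eq_third j rfl fun h => ?_
    have := congrArg Fin.val h
    omega
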